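/- **Model.** A *polyomino* is a finite nonempty set $P\subset\mathbb Z^2$ of cells (*tiles*) whose induced grid graph (cells at unit distance are adjacent) is connected; it is *monotone* if every vertical line, or every horizontal line, meets it in a connected set. A *workspace* is a bounded part of the grid whose cells are free, hold an obstacle, or hold one red or blue unit particle. Two particles stick together as soon as they are adjacent and have different colours; initially no two particles stick together. *Assemblies* are the connected components of particles sticking together. A *movement step* in one of the directions right, up, down, left moves every assembly, all simultaneously and at unit speed, in this direction until it is blocked by an obstacle or by a blocked assembly. The tiles of a polyomino are coloured in a checkerboard pattern. A *valid 2-cut* of a polyomino $P$ (straight or not) splits $P$ into two polyominoes $A,B$ (disjoint, with $A\cup B=P$) that can be pulled apart into two opposite grid directions without blocking each other: for a direction $d$ and every relative displacement $k\ge 1$, the translate $A+kd$ is disjoint from $B$ and no tile of $A+kd$ is adjacent to a tile of $B$ of the other colour (it would stick to it). A *decomposition tree* of $P$ is a finite binary tree of polyominoes with root $P$ in which the two children of each inner node are the parts of a valid 2-cut of it and every leaf is monotone. **Theorem.** Let $P$ be a polyomino that has a decomposition tree of valid 2-cuts. Then there is a labyrinth (a finite region $B$ of the grid with a fixed set $L\subseteq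 B$ of obstacle-free cells) and a number $c$ such that, under the endless repetition of the cycle of seven movement steps $$\text{right, up, down, up, right, left, down},$$ the labyrinth constructs $P$ and can be used for pipelining. That is, for every $D\ge 0$ there is a workspace whose obstacle-free cells within $B$ are exactly those of $L$ (outside of $B$ it may depend on $D$, e.g. contain depots of single particles) such that, during the first $c+D$ cycles, particles begin to stick together only inside $B$, and such that for each $1\le j\le D$ at least $j$ assemblies are translates of $P$ after $c+j$ cycles. In particular, for $D\ge1$, a copy of $P$ has been constructed after $c+1$ cycles, and $D$ copies take $c+D$ cycles, where $B$, $L$ and $c$ do not depend on $D$. -/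

import Mathlib

namespace TiltAssembly

/-! ## Polyominoes -/

/-- A cell of the planar grid, named by its column and its row (rows are counted upwards). -/
abbrev Cell : Type := ℤ × ℤ

/-- The grid graph on `ℤ²`: two cells are adjacent if they are at unit distance. -/
def gridGraph : SimpleGraph Cell where
  Adj p q := |p.1 - q.1| + |p.2 - q.2| = 1
  symm := ⟨fun p q h => by rwa [abs_sub_comm q.1, abs_sub_comm q.2]⟩
  loopless := ⟨fun p h => by simp at h⟩

/-- A polyomino: a finite, nonempty set of cells whose induced grid graph is connected. -/
def IsPolyomino (P : Finset Cell) : Prop :=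
  (gridGraph.induce (P : Set Cell)).Connected

/-- Column convex: every vertical line meets `P` in a connected set (`x`-monotone). -/
def ColumnConvex (P : Finset Cell) : Prop :=
  ∀ x y₁ y y₂ : ℤ, (x, y₁) ∈ P → (x, y₂) ∈ P → y₁ ≤ y → y ≤ y₂ → (x, y) ∈ P

/-- Row convex: every horizontal line meets `P` in a connected set (`y`-monotone). -/
def RowConvex (P : Finset Cell) : Prop :=
  ∀ y x₁ x x₂ : ℤ, (x₁, y) ∈ P → (x₂, y) ∈ P → x₁ ≤ x → x ≤ x₂ → (x, y) ∈ P

/-- A monotone polyomino: `x`-monotone or `y`-monotone. -/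
def IsMonotonePolyomino (P : Finset Cell) : Prop :=
  IsPolyomino P ∧ (ColumnConvex P ∨ RowConvex P)

/-! ## Directions, 2-cuts and decomposition trees -/

/-- The four directions. -/
inductive Dir
  | right
  | up
  | left
  | down

/-- The unit vector of a direction. -/
def Dir.vec : Dir → Cell
  | .right => (1, 0)
  | .up => (0, 1)
  | .left => (-1, 0)
  | .down => (0, -1)

/-- The colour (blue or red) of a tile of a polyomino.  All neighbouring tiles of a polyomino have
to stick, that is, to differ in colour, so the colours form a checkerboard pattern. -/
def tileColor (p : Cell) : Bool := decide (Even (p.1 + p.2))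

/-- `A` and `B` can be pulled apart, `A` in direction `d` and `B` in the opposite direction,
without blocking each other.  Only the displacement `k` of `A` relative to `B` matters.
While they are being pulled apart, no tile of `A` may run into a tile of `B`, and no tile of `A`
may pass next to a tile of `B` of the other colour, since the two would stick. -/
def CanPullApart (d : Dir) (A B : Finset Cell) : Prop :=
  ∀ k : ℕ, 0 < k → ∀ p ∈ A, ∀ q ∈ B,
    p + k • d.vec ≠ q ∧
    ¬ (tileColor p ≠ tileColor q ∧ gridGraph.Adj (p + k • d.vec) q)

/-- A valid 2-cut of the polyomino `P`, straight or not, given by the two subpolyominoes `A` and `B` into which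
it splits `P`: they can be pulled apart into opposite directions.  (The cut itself is the curve
formed by the common sides of tiles of `A` with tiles of `B`, continued outside of `P`.) -/
def IsValidTwoCut (P A B : Finset Cell) : Prop :=
  IsPolyomino P ∧ IsPolyomino A ∧ IsPolyomino B ∧ Disjoint A B ∧ A ∪ B = P ∧
    ∃ d : Dir, CanPullApart d A B

/-- A decomposition tree of `P`: each inner node carries a valid 2-cut, whose two subpolyominoes
are decomposed by the two subtrees, and each leaf carries a monotone polyomino. -/
inductive DecompositionTree : Finset Cell → Type
  | leaf (P : Finset Cell) (h : IsMonotonePolyomino P) : DecompositionTree P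
  | node (P A B : Finset Cell) (h : IsValidTwoCut P A B)
      (left : DecompositionTree A) (right : DecompositionTree B) : DecompositionTree P

/-! ## Workspaces and movement steps -/

/-- Two particles stick together if their colours differ and their cells are adjacent.
(Particles that stick move together from then on, so this graph only ever gains edges.) -/
def bondGraph {n : ℕ} (color : Fin n → Bool) (pos : Fin n → Cell) : SimpleGraph (Fin n) where
  Adj i j := color i ≠ color j ∧ gridGraph.Adj (pos i) (pos j)
  symm := ⟨fun _ _ h => ⟨h.1.symm, h.2.symm⟩⟩
  loopless := ⟨fun _ h => h.1 rfl⟩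

/-- A workspace: a bounded part of the grid with obstacles, together with an initial placement of
coloured unit-square particles, none of which stick together initially. -/
structure Workspace where
  /-- the cells that hold no obstacle; every other cell of the grid is an obstacle -/
  room : Finset Cell
  /-- the number of particles -/
  n : ℕ
  /-- the colours of the particles -/
  color : Fin n → Bool
  /-- the initial cells of the particles -/
  start : Fin n → Cell
  start_injective : Function.Injective start
  start_mem : ∀ i, start i ∈ room
  start_loose : ∀ i j, ¬ (bondGraph color start).Adj i j

namespace Workspace

variable (W : Workspace)

/-- The particles that cannot move one cell in direction `d`: those in front of an obstacle, those
in front of a blocked particle, and those that stick to a blocked particle. -/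
inductive Blocked (d : Dir) (pos : Fin W.n → Cell) : Fin W.n → Prop
  | obstacle (i : Fin W.n) : pos i + d.vec ∉ W.room → Blocked d pos i
  | behind (i j : Fin W.n) : pos i + d.vec = pos j → Blocked d pos j → Blocked d pos i
  | stuck (i j : Fin W.n) : (bondGraph W.color pos).Adj i j → Blocked d pos j → Blocked d pos i

open Classical in
/-- All particles that are not blocked move by one cell in direction `d`. -/
noncomputable def unitMotion (d : Dir) (pos : Fin W.n → Cell) : Fin W.n → Cell :=
  fun i => if W.Blocked d pos i then pos i else pos i + d.vec

/-- A movement step: every particle and every assembly moves in direction `d` until it is blocked.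
During a movement step a blocked particle stays blocked, and a particle that keeps moving would
leave the room after `W.room.card` unit motions, so that after so many of them all are blocked. -/
noncomputable def move (d : Dir) (pos : Fin W.n → Cell) : Fin W.n → Cell :=
  (W.unitMotion d)^[W.room.card] pos

/-- The positions of the particles after the first `m` movement steps of the sequence `σ`. -/
noncomputable def config (σ : ℕ → Dir) : ℕ → Fin W.n → Cell
  | 0 => W.start
  | m + 1 => W.move (σ m) (config σ m)

/-- The number of copies of `P` among the assemblies, that is, the number of connected components
of particles sticking together that occupy exactly a translate of `P`. -/
noncomputable def copies (pos : Fin W.n → Cell) (P : Finset Cell) : ℕ :=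
  {a : (bondGraph W.color pos).ConnectedComponent |
    ∃ v : Cell, pos '' a.supp = (fun p => p + v) '' (P : Set Cell)}.ncard

/-- During the first `M` movement steps of `σ`, whenever two particles begin to stick together,
both of them are inside the region `B`. -/
def SticksOnlyWithin (B : Finset Cell) (σ : ℕ → Dir) (M : ℕ) : Prop :=
  ∀ m < M, ∀ t : ℕ, ∀ i j : Fin W.n,
    ¬ (bondGraph W.color ((W.unitMotion (σ m))^[t] (W.config σ m))).Adj i j →
    (bondGraph W.color ((W.unitMotion (σ m))^[t + 1] (W.config σ m))).Adj i j →
    (W.unitMotion (σ m))^[t + 1] (W.config σ m) i ∈ B ∧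
    (W.unitMotion (σ m))^[t + 1] (W.config σ m) j ∈ B

end Workspace

/-- The cycle right, up, down, up, right, left, down, repeated forever. -/
def sevenCycle (m : ℕ) : Dir :=
  ![Dir.right, Dir.up, Dir.down, Dir.up, Dir.right, Dir.left, Dir.down] (Fin.ofNat 7 m)

/-- The labyrinth given by a region `B` and the set `L` of its obstacle-free cells constructs `P`
under the repeated cycle of seven movement steps, with start-up time `c`, and can be used for
pipelining: for every `D` it can be embedded into a workspace (with depots for the particles needed
for `D` copies) in which particles begin to stick together only inside the labyrinth and in which
one more copy of `P` is completed in every cycle, starting with the first one after `c + 1` cycles,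
until there are `D` copies. -/
def PipelineConstructs (B L : Finset Cell) (c : ℕ) (P : Finset Cell) : Prop :=
  ∀ D : ℕ, ∃ W : Workspace,
    W.room ∩ B = L ∧
    W.SticksOnlyWithin B sevenCycle (7 * (c + D)) ∧
    (1 ≤ D → 1 ≤ W.copies (W.config sevenCycle (7 * (c + 1))) P) ∧
    ∀ j ≤ D, j ≤ W.copies (W.config sevenCycle (7 * (c + j))) P

end TiltAssembly

namespace TiltAssembly

/-! ## Coordinates along and across a direction -/

/-! The proof works on two scales. On the coarse scale a tile `p` has a macro position `g p s` at
every integer time `s`; on the fine scale it stands in the cell `p + N • g p s`, where `N` exceeds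
the extent of `P`. Tiles at one macro vertex then have the relative position that they have in `P`,
and resting tiles at different vertices do not touch. Within a large box, the obstacle-free cells
are exactly those that some tile sweeps over at some time. Hence a group of tiles stops at a vertex
if the cell in front of one of its tiles is never swept. All copies of `P` use the same tracks,
delayed by multiples of seven steps. `Valid` collects conditions on the order of macro positions,
and on the final approach of joining tiles, under which this works.

`Flow` is the induction hypothesis: trajectories that have assembled `P` at time `0`, when they
leave the left half plane, and that stay in a diagonal strip, just as the conveyor `conv` advances
by `(1, -1)` per cycle. To join the two parts of a cut, their flows are placed so far apart
vertically that the strips are disjoint (`Valid.union`), and are continued in the right half plane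
(`Valid.glue`) by a finite table of positions of two tokens, which `decide` checks. The approach
reverses the pulling apart of the cut. There are six tables; which one applies depends on which part
extends further sideways or upwards, since this decides where an obstacle can hold one part without
being in the way of the other (`Flow.vertical`, `Flow.horizontal`). `Flow.join` moves the result
back to the origin.

This handles the inner nodes of the decomposition tree. A monotone leaf is cut line by line and then
tile by tile (`hasFlow_of_lineConvex`), and a single tile just rides on the conveyor.

Finally, a finished copy rides on the conveyor forever (`Flow.eternal`). `Runs.blocked_iff` shows
that the movement rule reproduces the trajectories: a particle is blocked exactly when it has
travelled its planned distance. One copy per cycle passes its time `0`, and bonds form only in a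
bounded period before that time, hence inside a fixed box, the labyrinth. -/

/-- The direction of the `s`-th step of the seven-step cycle, continued to negative times. -/
def cyc (s : ℤ) : Dir := sevenCycle (s % 7).toNat

/-- The coordinate that grows in direction `d`. -/
def along : Dir → Cell → ℤ
  | .right, v => v.1
  | .up, v => v.2
  | .left, v => -v.1
  | .down, v => -v.2

/-- The coordinate that a motion in direction `d` does not change. -/
def across : Dir → Cell → ℤ
  | .right, v => v.2
  | .up, v => v.1
  | .left, v => v.2
  | .down, v => v.1

/-- `b` is reached from `a` by a (possibly trivial) motion in direction `d`. -/
def StepTo (d : Dir) (a b : Cell) : Prop := across d a = across d b ∧ along d a ≤ along d b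

/-- `b` lies strictly ahead of `a` on a line parallel to `d`. -/
def Ahead (d : Dir) (a b : Cell) : Prop := across d a = across d b ∧ along d a < along d b

instance (d : Dir) (a b : Cell) : Decidable (StepTo d a b) := by unfold StepTo; infer_instance

instance (d : Dir) (a b : Cell) : Decidable (Ahead d a b) := by unfold Ahead; infer_instance

/-- A tile `p` that approaches its final place relative to `q` in direction `d` neither runs into
`q` nor sticks to it before it has arrived. -/
def NoTouch (d : Dir) (p q : Cell) : Prop :=
  ∀ k : ℕ, 0 < k → p ≠ q + k • d.vec ∧
    ¬ (tileColor p ≠ tileColor q ∧ gridGraph.Adj p (q + k • d.vec))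

/-- Lexicographic order on a coarse coordinate and a fine one. -/
def LexLE (a p w c : ℤ) : Prop := a < w ∨ (a = w ∧ p ≤ c)

/-- `(w, c)` lies between `(a, p)` and `(b, p)` in the lexicographic order. -/
def LexBetween (a b p w c : ℤ) : Prop :=
  (LexLE a p w c ∧ LexLE w c b p) ∨ (LexLE b p w c ∧ LexLE w c a p)

/-- The tile `p`, moving from the macro vertex `a` to the macro vertex `b`, sweeps over the cell
`c` at the macro vertex `w`. -/
def Hit (a b w p c : Cell) : Prop :=
  LexBetween a.1 b.1 p.1 w.1 c.1 ∧ LexBetween a.2 b.2 p.2 w.2 c.2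

/-- `w` lies on the segment from `a` to `b`. -/
def OnSeg (a b w : Cell) : Prop :=
  ((a.1 ≤ w.1 ∧ w.1 ≤ b.1) ∨ (b.1 ≤ w.1 ∧ w.1 ≤ a.1)) ∧
  ((a.2 ≤ w.2 ∧ w.2 ≤ b.2) ∨ (b.2 ≤ w.2 ∧ w.2 ≤ a.2))

instance (a b w : Cell) : Decidable (OnSeg a b w) := by unfold OnSeg; infer_instance

/-- The segment from `a` to `b` extends beyond `w` in direction `e`. -/
def Beyond (e : Dir) (a b w : Cell) : Prop := along e w < along e a ∨ along e w < along e b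

instance (e : Dir) (a b w : Cell) : Decidable (Beyond e a b w) := by unfold Beyond; infer_instance

theorem Hit.onSeg {a b w p c : Cell} (h : Hit a b w p c) : OnSeg a b w := by
  simp only [Hit, LexBetween, LexLE] at h
  simp only [OnSeg]
  omega

/-- A segment that does not extend beyond `w` in direction `e` takes `p` no further there than to
its own offset at `w`. Cells with a larger offset are thus available for obstacles. -/
theorem Hit.along_le {e : Dir} {a b w p c : Cell} (h : Hit a b w p c) (hb : ¬ Beyond e a b w) :
    along e c ≤ along e p := by
  simp only [Hit, LexBetween, LexLE] at h
  cases e <;> simp only [Beyond, along] at hb ⊢ <;> omega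

theorem along_add_vec (d : Dir) (q : Cell) : along d (q + d.vec) = along d q + 1 := by
  cases d <;> simp [along, Dir.vec] <;> ring

theorem cyc_add (s k : ℤ) : cyc (s + 7 * k) = cyc s := by
  simp [cyc, Int.add_mul_emod_self_left]

theorem cyc_congr {s t : ℤ} (h : s % 7 = t % 7) : cyc s = cyc t := by
  simp [cyc, h]

theorem cyc_eq_right {s : ℤ} (h : s % 7 = 0) : cyc s = .right := by
  simp [cyc, h, sevenCycle]

theorem sevenCycle_eq_cyc (m : ℕ) : sevenCycle m = cyc m := by
  have : ((m : ℤ) % 7).toNat = m % 7 := by omega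
  simp only [cyc, this, sevenCycle]
  congr 1
  ext
  simp [Fin.ofNat]

/-! ## Macro trajectories -/

/-- The tiles of `S` that can be reached from `p` through adjacent tiles of `S`. -/
def Linked (S : Set Cell) (p q : Cell) : Prop :=
  Relation.ReflTransGen (fun a b => gridGraph.Adj a b ∧ b ∈ S) p q

/-- Macro trajectories `g` of the tiles of `P`, where the tile `p` is at the macro vertex `g p s` at
time `s`, are valid for the steps in `I`, with a new copy of `P` started in each cycle, if the room
consists of what the steps in `J` sweep over. -/
structure Valid (I J : Set ℤ) (P : Finset Cell) (g : Cell → ℤ → Cell) : Prop where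
  step : ∀ s ∈ I, ∀ p ∈ P, StepTo (cyc s) (g p s) (g p (s + 1))
  together : ∀ s ∈ I, ∀ p ∈ P, ∀ q ∈ P, g p s = g q s → g p (s + 1) = g q (s + 1)
  apart : ∀ s ∈ I, ∀ s' ∈ I, s % 7 = s' % 7 → s ≠ s' → ∀ p ∈ P, ∀ q ∈ P, g p s ≠ g q s' ∧
    (Ahead (cyc s) (g p s) (g q s') → Ahead (cyc s) (g p (s + 1)) (g q (s' + 1)))
  meet : ∀ s ∈ I, ∀ p ∈ P, ∀ q ∈ P, Ahead (cyc s) (g p s) (g q s) →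
    Ahead (cyc s) (g p (s + 1)) (g q (s + 1)) ∨
      (g p (s + 1) = g q (s + 1) ∧ NoTouch (cyc s) p q)
  halt : ∀ s ∈ I, ∀ p ∈ P, ∃ q ∈ P, g q (s + 1) = g p (s + 1) ∧
    (g q s = g p s ∨ (Ahead (cyc s) (g p s) (g q s) ∧
      ∀ r ∈ P, g r (s + 1) = g p (s + 1) → ¬ Ahead (cyc s) (g r s) (g p s))) ∧
    ∀ r ∈ P, ∀ s' ∈ J, ¬ Hit (g r s') (g r (s' + 1)) (g q (s + 1)) r (q + (cyc s).vec)
  conn : ∀ s ∈ I, ∀ p ∈ P, ∀ q ∈ P, g p s = g q s → Linked {r | r ∈ P ∧ g r s = g p s} p q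

/-! ### Operations that preserve validity -/

theorem Valid.mono {I J I' J' : Set ℤ} {P : Finset Cell} {g : Cell → ℤ → Cell}
    (h : Valid I J P g) (hI : I' ⊆ I) (hJ : J' ⊆ J) : Valid I' J' P g where
  step s hs := h.step s (hI hs)
  together s hs := h.together s (hI hs)
  apart s hs s' hs' := h.apart s (hI hs) s' (hI hs')
  meet s hs := h.meet s (hI hs)
  halt s hs p hp := by
    obtain ⟨q, hq, h1, h2, h3⟩ := h.halt s (hI hs) p hp
    exact ⟨q, hq, h1, h2, fun r hr s' hs' => h3 r hr s' (hJ hs')⟩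
  conn s hs := h.conn s (hI hs)

/-- Validity only depends on the values of the trajectories at the relevant times. -/
theorem Valid.congr {I J : Set ℤ} {P : Finset Cell} {g g' : Cell → ℤ → Cell}
    (h : Valid I J P g) (hI : ∀ p ∈ P, ∀ s ∈ I, g' p s = g p s ∧ g' p (s + 1) = g p (s + 1))
    (hJ : ∀ p ∈ P, ∀ s ∈ J, g' p s = g p s ∧ g' p (s + 1) = g p (s + 1)) : Valid I J P g' where
  step s hs p hp := by
    rw [(hI p hp s hs).1, (hI p hp s hs).2]; exact h.step s hs p hp
  together s hs p hp q hq := by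
    rw [(hI p hp s hs).1, (hI p hp s hs).2, (hI q hq s hs).1, (hI q hq s hs).2]
    exact h.together s hs p hp q hq
  apart s hs s' hs' e ne p hp q hq := by
    rw [(hI p hp s hs).1, (hI p hp s hs).2, (hI q hq s' hs').1, (hI q hq s' hs').2]
    exact h.apart s hs s' hs' e ne p hp q hq
  meet s hs p hp q hq := by
    rw [(hI p hp s hs).1, (hI p hp s hs).2, (hI q hq s hs).1, (hI q hq s hs).2]
    exact h.meet s hs p hp q hq
  halt s hs p hp := by
    obtain ⟨q, hq, h1, h2, h3⟩ := h.halt s hs p hp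
    refine ⟨q, hq, ?_, ?_, fun r hr s' hs' => ?_⟩
    · rw [(hI p hp s hs).2, (hI q hq s hs).2]; exact h1
    · rw [(hI p hp s hs).1, (hI p hp s hs).2, (hI q hq s hs).1]
      refine h2.imp id (And.imp id fun h2 r hr => ?_)
      rw [(hI r hr s hs).1, (hI r hr s hs).2]; exact h2 r hr
    · rw [(hI q hq s hs).2, (hJ r hr s' hs').1, (hJ r hr s' hs').2]; exact h3 r hr s' hs'
  conn s hs p hp q hq e := by
    have : {r | r ∈ P ∧ g' r s = g' p s} = {r | r ∈ P ∧ g r s = g p s} := by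
      ext r
      simp only [Set.mem_ofPred_eq]
      refine and_congr_right fun hr => ?_
      rw [(hI p hp s hs).1, (hI r hr s hs).1]
    rw [this]
    rw [(hI p hp s hs).1, (hI q hq s hs).1] at e
    exact h.conn s hs p hp q hq e

/-- Shifting the time by whole cycles. -/
theorem Valid.shift {I J : Set ℤ} {P : Finset Cell} {g : Cell → ℤ → Cell} (h : Valid I J P g)
    (k : ℤ) : Valid {s | s + 7 * k ∈ I} {s | s + 7 * k ∈ J} P (fun p s => g p (s + 7 * k)) := by
  have e : ∀ s : ℤ, s + 1 + 7 * k = s + 7 * k + 1 := fun s => by ring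
  constructor
  · intro s hs p hp
    simp only [e]; rw [← cyc_add s k]; exact h.step _ hs p hp
  · intro s hs p hp q hq
    simp only [e]; exact h.together _ hs p hp q hq
  · intro s hs s' hs' hm hne p hp q hq
    simp only [e]; rw [← cyc_add s k]
    exact h.apart _ hs _ hs' (by omega) (by omega) p hp q hq
  · intro s hs p hp q hq
    simp only [e]; rw [← cyc_add s k]; exact h.meet _ hs p hp q hq
  · intro s hs p hp
    obtain ⟨q, hq, h1, h2, h3⟩ := h.halt _ hs p hp
    rw [cyc_add] at h2 h3
    refine ⟨q, hq, ?_, ?_, fun r hr s' hs' => ?_⟩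
    · simp only [e]; exact h1
    · simp only [e]; exact h2
    · simp only [e]; exact h3 r hr _ hs'
  · intro s hs p hp q hq
    exact h.conn _ hs p hp q hq

/-- Monotone relabelling of the macro coordinates. -/
def relabel (ξ ψ : ℤ → ℤ) (v : Cell) : Cell := (ξ v.1, ψ v.2)

theorem relabel_inj {ξ ψ : ℤ → ℤ} (hξ : StrictMono ξ) (hψ : StrictMono ψ)
    {v w : Cell} : relabel ξ ψ v = relabel ξ ψ w ↔ v = w := by
  simp [relabel, Prod.ext_iff, hξ.injective.eq_iff, hψ.injective.eq_iff]

theorem stepTo_relabel {ξ ψ : ℤ → ℤ} (hξ : StrictMono ξ) (hψ : StrictMono ψ)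
    {d : Dir} {v w : Cell} :
    StepTo d (relabel ξ ψ v) (relabel ξ ψ w) ↔ StepTo d v w := by
  cases d <;> simp [StepTo, relabel, along, across, hξ.injective.eq_iff, hψ.injective.eq_iff,
    hξ.le_iff_le, hψ.le_iff_le]

theorem ahead_relabel {ξ ψ : ℤ → ℤ} (hξ : StrictMono ξ) (hψ : StrictMono ψ)
    {d : Dir} {v w : Cell} :
    Ahead d (relabel ξ ψ v) (relabel ξ ψ w) ↔ Ahead d v w := by
  cases d <;> simp [Ahead, relabel, along, across, hξ.injective.eq_iff, hψ.injective.eq_iff,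
    hξ.lt_iff_lt, hψ.lt_iff_lt]

theorem hit_relabel {ξ ψ : ℤ → ℤ} (hξ : StrictMono ξ) (hψ : StrictMono ψ)
    {a b w p c : Cell} :
    Hit (relabel ξ ψ a) (relabel ξ ψ b) (relabel ξ ψ w) p c ↔ Hit a b w p c := by
  simp [Hit, LexBetween, LexLE, relabel, hξ.injective.eq_iff, hψ.injective.eq_iff,
    hξ.lt_iff_lt, hψ.lt_iff_lt]

/-- Validity uses macro coordinates only through equality and order. This allows tables to be
stretched and flows to be translated. -/
theorem Valid.relabel {ξ ψ : ℤ → ℤ} (hξ : StrictMono ξ) (hψ : StrictMono ψ)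
    {I J : Set ℤ} {P : Finset Cell} {g : Cell → ℤ → Cell} (h : Valid I J P g) :
    Valid I J P (fun p s => relabel ξ ψ (g p s)) := by
  constructor
  · intro s hs p hp
    rw [stepTo_relabel hξ hψ]; exact h.step s hs p hp
  · intro s hs p hp q hq
    rw [relabel_inj hξ hψ, relabel_inj hξ hψ]; exact h.together s hs p hp q hq
  · intro s hs s' hs' hm hne p hp q hq
    rw [Ne, relabel_inj hξ hψ, ahead_relabel hξ hψ, ahead_relabel hξ hψ]
    exact h.apart s hs s' hs' hm hne p hp q hq
  · intro s hs p hp q hq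
    rw [relabel_inj hξ hψ, ahead_relabel hξ hψ, ahead_relabel hξ hψ]
    exact h.meet s hs p hp q hq
  · intro s hs p hp
    obtain ⟨q, hq, h1, h2, h3⟩ := h.halt s hs p hp
    refine ⟨q, hq, ?_, ?_, fun r hr s' hs' => ?_⟩
    · rw [h1]
    · simp only [relabel_inj hξ hψ, ahead_relabel hξ hψ]; exact h2
    · rw [hit_relabel hξ hψ]; exact h3 r hr s' hs'
  · intro s hs p hp q hq
    simp only [relabel_inj hξ hψ]
    exact h.conn s hs p hp q hq

theorem Linked.mono {S T : Set Cell} (h : S ⊆ T) {p q : Cell} (hl : Linked S p q) :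
    Linked T p q :=
  Relation.ReflTransGen.mono (fun a b (hab : gridGraph.Adj a b ∧ b ∈ S) => ⟨hab.1, h hab.2⟩) p q hl

theorem IsPolyomino.linked {P : Finset Cell} (h : IsPolyomino P) {p q : Cell} (hp : p ∈ P)
    (hq : q ∈ P) : Linked (P : Set Cell) p q := by
  have := (SimpleGraph.reachable_iff_reflTransGen _ _).1
    (h.preconnected ⟨p, hp⟩ ⟨q, hq⟩)
  exact Relation.ReflTransGen.lift (p := fun a b => gridGraph.Adj a b ∧ b ∈ (P : Set Cell))
    (Subtype.val : ↥(P : Set Cell) → Cell) (fun a b hab => ⟨hab, b.2⟩) _ _ this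

/-! ## Two groups of tiles in disjoint strips -/

/-- Flows in disjoint diagonal strips do not interfere. -/
theorem Valid.union {I J : Set ℤ} {U L : Finset Cell} {g : Cell → ℤ → Cell}
    (hU : Valid I J U g) (hL : Valid I J L g) {h : ℤ}
    (hbU : ∀ p ∈ U, ∀ s ∈ I ∪ J, h < (g p s).1 + (g p s).2 ∧ h < (g p (s + 1)).1 + (g p (s + 1)).2)
    (hbL : ∀ p ∈ L, ∀ s ∈ I ∪ J,
      (g p s).1 + (g p s).2 ≤ h ∧ (g p (s + 1)).1 + (g p (s + 1)).2 ≤ h)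
    (hstep : ∀ s ∈ J, ∀ p ∈ U ∪ L, StepTo (cyc s) (g p s) (g p (s + 1))) :
    Valid I J (U ∪ L) g := by
  have ne : ∀ p ∈ U, ∀ q ∈ L, ∀ s ∈ I, ∀ s' ∈ I, g p s ≠ g q s' := by
    intro p hp q hq s hs s' hs' e
    have := (hbU p hp s (.inl hs)).1
    have := (hbL q hq s' (.inl hs')).1
    rw [e] at *
    omega
  have ne' : ∀ p ∈ U, ∀ q ∈ L, ∀ s ∈ I, ∀ s' ∈ I, g p (s + 1) ≠ g q (s' + 1) := by
    intro p hp q hq s hs s' hs' e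
    have := (hbU p hp s (.inl hs)).2
    have := (hbL q hq s' (.inl hs')).2
    rw [e] at *
    omega
  -- On a common line the tile of the upper strip is further right or further up. This holds before
  -- and after the step, so the order cannot change.
  have ah : ∀ p ∈ U, ∀ q ∈ L, ∀ s ∈ I, ∀ s' ∈ I, s % 7 = s' % 7 →
      (Ahead (cyc s) (g p s) (g q s') → Ahead (cyc s) (g p (s + 1)) (g q (s' + 1))) ∧
      (Ahead (cyc s) (g q s') (g p s) → Ahead (cyc s) (g q (s' + 1)) (g p (s + 1))) := by
    intro p hp q hq s hs s' hs' e
    have h1 := hbU p hp s (.inl hs)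
    have h2 := hbL q hq s' (.inl hs')
    have h3 := hU.step s hs p hp
    have h4 := hL.step s' hs' q hq
    rw [cyc_congr e.symm] at h4
    revert h3 h4
    cases cyc s <;> simp only [Ahead, StepTo, along, across] <;> omega
  have nohit : ∀ p ∈ U, ∀ q ∈ L, ∀ s ∈ I, ∀ s' ∈ J, ∀ c,
      ¬ Hit (g p s') (g p (s' + 1)) (g q (s + 1)) p c ∧
      ¬ Hit (g q s') (g q (s' + 1)) (g p (s + 1)) q c := by
    intro p hp q hq s hs s' hs' c
    have h1 := hbU p hp s (.inl hs)
    have h2 := hbL q hq s (.inl hs)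
    have h1' := hbU p hp s' (.inr hs')
    have h2' := hbL q hq s' (.inr hs')
    have h3 := hstep s' hs' p (Finset.mem_union_left _ hp)
    have h4 := hstep s' hs' q (Finset.mem_union_right _ hq)
    constructor <;> intro hh <;> replace hh := hh.onSeg <;> revert h3 h4 hh <;>
      cases cyc s' <;> simp only [OnSeg, StepTo, along, across] <;> omega
  constructor
  · intro s hs p hp
    rcases Finset.mem_union.1 hp with hp | hp
    exacts [hU.step s hs p hp, hL.step s hs p hp]
  · intro s hs p hp q hq e
    rcases Finset.mem_union.1 hp with hp | hp <;> rcases Finset.mem_union.1 hq with hq | hq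
    exacts [hU.together s hs p hp q hq e, (ne p hp q hq s hs s hs e).elim,
      (ne q hq p hp s hs s hs e.symm).elim, hL.together s hs p hp q hq e]
  · intro s hs s' hs' hm hne p hp q hq
    rcases Finset.mem_union.1 hp with hp | hp <;> rcases Finset.mem_union.1 hq with hq | hq
    · exact hU.apart s hs s' hs' hm hne p hp q hq
    · exact ⟨ne p hp q hq s hs s' hs', (ah p hp q hq s hs s' hs' hm).1⟩
    · refine ⟨(ne q hq p hp s' hs' s hs).symm, ?_⟩
      rw [cyc_congr hm]
      exact (ah q hq p hp s' hs' s hs hm.symm).2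
    · exact hL.apart s hs s' hs' hm hne p hp q hq
  · intro s hs p hp q hq e
    rcases Finset.mem_union.1 hp with hp | hp <;> rcases Finset.mem_union.1 hq with hq | hq
    exacts [hU.meet s hs p hp q hq e, .inl ((ah p hp q hq s hs s hs rfl).1 e),
      .inl ((ah q hq p hp s hs s hs rfl).2 e), hL.meet s hs p hp q hq e]
  · intro s hs p hp
    rcases Finset.mem_union.1 hp with hp | hp
    · obtain ⟨q, hq, h1, h2, h3⟩ := hU.halt s hs p hp
      refine ⟨q, Finset.mem_union_left _ hq, h1, h2.imp id (And.imp id fun h2 r hr e => ?_),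
        fun r hr s' hs' => ?_⟩
      · rcases Finset.mem_union.1 hr with hr | hr
        exacts [h2 r hr e, (ne' p hp r hr s hs s hs e.symm).elim]
      · rcases Finset.mem_union.1 hr with hr | hr
        exacts [h3 r hr s' hs', (nohit q hq r hr s hs s' hs' _).2]
    · obtain ⟨q, hq, h1, h2, h3⟩ := hL.halt s hs p hp
      refine ⟨q, Finset.mem_union_right _ hq, h1, h2.imp id (And.imp id fun h2 r hr e => ?_),
        fun r hr s' hs' => ?_⟩
      · rcases Finset.mem_union.1 hr with hr | hr
        exacts [(ne' r hr p hp s hs s hs e).elim, h2 r hr e]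
      · rcases Finset.mem_union.1 hr with hr | hr
        exacts [(nohit r hr q hq s hs s' hs' _).1, h3 r hr s' hs']
  · intro s hs p hp q hq e
    rcases Finset.mem_union.1 hp with hp | hp <;> rcases Finset.mem_union.1 hq with hq | hq
    · refine Linked.mono ?_ (hU.conn s hs p hp q hq e)
      exact fun r hr => ⟨Finset.mem_union_left _ hr.1, hr.2⟩
    · exact (ne p hp q hq s hs s hs e).elim
    · exact (ne q hq p hp s hs s hs e.symm).elim
    · refine Linked.mono ?_ (hL.conn s hs p hp q hq e)
      exact fun r hr => ⟨Finset.mem_union_right _ hr.1, hr.2⟩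

/-! ## Continuing a flow to the right -/

/-- A flow that stays in the half plane `x ≤ 0` until time `0`, continued by a flow that moves into
the half plane `x ≥ 1`. -/
theorem Valid.glue {P : Finset Cell} {g : Cell → ℤ → Cell} {I J : Set ℤ}
    (hold : Valid {s | s < 0} {s | s ≤ 0} P fun p s => if s ≤ 0 then g p s else (1, (g p 0).2))
    (hnew : Valid {s | 0 ≤ s ∧ s ∈ I} {s | 0 ≤ s ∧ s ∈ J} P g) (hI : 0 ∈ I)
    (hneg : ∀ p ∈ P, ∀ s ≤ 0, (g p s).1 ≤ 0)
    (hneg' : ∀ p ∈ P, ∀ s < 0, s % 7 = 0 → (g p s).1 < 0)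
    (h0 : ∀ p ∈ P, (g p 0).1 = 0)
    (hpos : ∀ p ∈ P, ∀ s ∈ I ∪ J,
      (1 ≤ s → 1 ≤ (g p s).1) ∧ (0 ≤ s → 1 ≤ (g p (s + 1)).1)) :
    Valid {s | 0 ≤ s → s ∈ I} {s | 0 ≤ s → s ∈ J} P g := by
  have hold' : Valid {s | s < 0} {s | s < 0} P g := by
    refine (hold.mono le_rfl fun s (hs : s < 0) => hs.le).congr ?_ ?_ <;>
    · intro p _ s (hs : s < 0)
      have h1 : s ≤ 0 := by omega
      have h2 : s + 1 ≤ 0 := by omega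
      simp [h1, h2]
  have right : ∀ p ∈ P, (g p 0).2 = (g p 1).2 ∧ (g p 0).1 ≤ (g p 1).1 := by
    intro p hp
    have := hnew.step 0 ⟨le_rfl, hI⟩ p hp
    simpa [StepTo, cyc_eq_right, along, across] using this
  have mixed : ∀ s < 0, ∀ s', 0 ≤ s' → s' ∈ I → s % 7 = s' % 7 → ∀ p ∈ P, ∀ q ∈ P,
      (g p s).1 < (g q s').1 ∧ (g p (s + 1)).1 < (g q (s' + 1)).1 := by
    intro s hs s' h1 h2 hm p hp q hq
    have a1 := hneg p hp s hs.le
    have a2 := hneg p hp (s + 1) (by omega)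
    have a3 := (hpos q hq s' (.inl h2)).2 h1
    refine ⟨?_, by omega⟩
    -- At time `0` the new flow is still in column `0`, so strictness has to come from the old flow
    -- being in a negative column at earlier cycle starts.
    rcases eq_or_lt_of_le h1 with h1 | h1
    · have := hneg' p hp s hs (by omega)
      rw [← h1, h0 q hq]; exact this
    · have := (hpos q hq s' (.inl h2)).1 (by omega)
      omega
  have mixed' : ∀ d : Dir, ∀ a b a' b' : Cell, a.1 < b.1 → a'.1 < b'.1 → StepTo d a a' →
      StepTo d b b' → a ≠ b ∧ (Ahead d a b → Ahead d a' b') ∧ (Ahead d b a → Ahead d b' a') := by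
    intro d a b a' b' h1 h2
    refine fun h3 h4 => ⟨fun e => by rw [e] at h1; exact lt_irrefl _ h1, ?_⟩
    revert h3 h4
    cases d <;> simp only [StepTo, Ahead, along, across] <;> omega
  constructor
  · intro s hs p hp
    rcases lt_or_ge s 0 with h | h
    exacts [hold'.step s h p hp, hnew.step s ⟨h, hs h⟩ p hp]
  · intro s hs p hp
    rcases lt_or_ge s 0 with h | h
    exacts [hold'.together s h p hp, hnew.together s ⟨h, hs h⟩ p hp]
  · intro s hs s' hs' hm hne p hp q hq
    rcases lt_or_ge s 0 with h | h <;> rcases lt_or_ge s' 0 with h' | h'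
    · exact hold'.apart s h s' h' hm hne p hp q hq
    · obtain ⟨m1, m2⟩ := mixed s h s' h' (hs' h') hm p hp q hq
      have := mixed' (cyc s) _ _ _ _ m1 m2 (hold'.step s h p hp)
        (cyc_congr hm ▸ hnew.step s' ⟨h', hs' h'⟩ q hq)
      exact ⟨this.1, this.2.1⟩
    · obtain ⟨m1, m2⟩ := mixed s' h' s h (hs h) hm.symm q hq p hp
      have := mixed' (cyc s) _ _ _ _ m1 m2 (cyc_congr hm ▸ hold'.step s' h' q hq)
        (hnew.step s ⟨h, hs h⟩ p hp)
      exact ⟨this.1.symm, this.2.2⟩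
    · exact hnew.apart s ⟨h, hs h⟩ s' ⟨h', hs' h'⟩ hm hne p hp q hq
  · intro s hs p hp
    rcases lt_or_ge s 0 with h | h
    exacts [hold'.meet s h p hp, hnew.meet s ⟨h, hs h⟩ p hp]
  · intro s hs p hp
    rcases lt_or_ge s 0 with h | h
    · obtain ⟨q, hq, h1, h2, h3⟩ := hold.halt s h p hp
      have e0 : s ≤ 0 := by omega
      have e1 : s + 1 ≤ 0 := by omega
      simp only [e0, e1, if_true] at h1 h2 h3
      refine ⟨q, hq, h1, h2, fun r hr s' hs' hh => ?_⟩
      have hw := hneg q hq (s + 1) e1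
      rcases lt_trichotomy s' 0 with h' | h' | h'
      · have := h3 r hr s' h'.le
        have e2 : s' ≤ 0 := by omega
        have e3 : s' + 1 ≤ 0 := by omega
        simp only [e2, e3, if_true] at this
        exact this hh
      -- The old flow pretends to stop in column `1` in this step, while the new one may go further.
      -- At vertices in columns `≤ 0` both sweep the same cells.
      · subst h'
        refine h3 r hr 0 (Set.mem_ofPred.2 le_rfl) ?_
        obtain ⟨hr1, hr2⟩ := right r hr
        have hr3 := h0 r hr
        have hr4 := (hpos r hr 0 (.inl hI)).2 le_rfl
        rw [zero_add] at hr4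
        revert hh
        simp only [Hit, LexBetween, LexLE, zero_add, le_refl, if_true]
        norm_num
        omega
      · have a1 := (hpos r hr s' (.inr (hs' h'.le))).1 (by omega)
        have a2 := (hpos r hr s' (.inr (hs' h'.le))).2 h'.le
        have := hh.onSeg
        simp only [OnSeg] at this
        omega
    · obtain ⟨q, hq, h1, h2, h3⟩ := hnew.halt s ⟨h, hs h⟩ p hp
      refine ⟨q, hq, h1, h2, fun r hr s' hs' hh => ?_⟩
      rcases lt_or_ge s' 0 with h' | h'
      · have a1 := (hpos q hq s (.inl (hs h))).2 h
        have a2 := hneg r hr s' (by omega)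
        have a3 := hneg r hr (s' + 1) (by omega)
        have := hh.onSeg
        simp only [OnSeg] at this
        omega
      · exact h3 r hr s' ⟨h', hs' h'⟩ hh
  · intro s hs p hp
    rcases lt_or_ge s 0 with h | h
    exacts [hold'.conn s h p hp, hnew.conn s ⟨h, hs h⟩ p hp]

/-! ## The conveyor -/

/-- The trajectory on the standard conveyor, which moves by `(1, -1)` in each cycle. -/
def conv (s : ℤ) : Cell :=
  if s % 7 = 0 then (s / 7, -(s / 7))
  else (s / 7 + 1, -(s / 7) + if s % 7 = 1 then 0 else if s % 7 = 3 then -1 else 1)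

theorem exists_cycle_offset (s : ℤ) : ∃ k : ℤ, ∃ i : ℕ, i < 7 ∧ s = 7 * k + i :=
  ⟨s / 7, (s % 7).toNat, by omega, by omega⟩

/-- The height of the standard conveyor within a cycle. -/
def convHeight (i : ℕ) : ℤ := if i = 0 ∨ i = 1 then 0 else if i = 3 ∨ i = 7 then -1 else 1

theorem conv_eq (k : ℤ) (i : ℕ) (hi : i ≤ 7) :
    conv (7 * k + i) = (k + (if i = 0 then 0 else 1), -k + convHeight i) := by
  interval_cases i <;> simp [conv, convHeight, Int.add_emod, Int.add_ediv]
  ring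

theorem sevenCycle_values : sevenCycle 0 = .right ∧ sevenCycle 1 = .up ∧ sevenCycle 2 = .down ∧
    sevenCycle 3 = .up ∧ sevenCycle 4 = .right ∧ sevenCycle 5 = .left ∧ sevenCycle 6 = .down :=
  ⟨rfl, rfl, rfl, rfl, rfl, rfl, rfl⟩

theorem cyc_eq (k : ℤ) (i : ℕ) : cyc (7 * k + i) = sevenCycle i := by
  rw [add_comm, cyc_add, sevenCycle_eq_cyc]

theorem exists_max_along {P : Finset Cell} (h : P.Nonempty) (d : Dir) :
    ∃ q ∈ P, ∀ r ∈ P, along d r ≤ along d q := P.exists_max_image _ h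

theorem IsPolyomino.nonempty {P : Finset Cell} (h : IsPolyomino P) : P.Nonempty := by
  obtain ⟨⟨x, hx⟩⟩ := SimpleGraph.Connected.nonempty h
  exact ⟨x, hx⟩

/-- Different copies at the same phase differ in both coordinates, so they never share a line. At
each stop, no conveyor segment through the vertex continues in the direction of the step, so the
cell in front of a foremost tile is never swept. -/
theorem conv_valid {A : Finset Cell} (hA : IsPolyomino A) :
    Valid Set.univ Set.univ A (fun _ => conv) := by
  have e1 : ∀ (k : ℤ) (i : ℕ), 7 * k + (i : ℤ) + 1 = 7 * k + ((i + 1 : ℕ) : ℤ) := by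
    intro k i; push_cast; ring
  constructor
  · intro s _ p _
    obtain ⟨k, i, hi, rfl⟩ := exists_cycle_offset s
    rw [e1, cyc_eq, conv_eq _ _ (by omega), conv_eq _ _ (by omega)]
    interval_cases i <;> simp [sevenCycle_values, StepTo, along, across, convHeight]
  · intros; rfl
  · intro s _ s' _ hm hne p _ q _
    obtain ⟨k, i, hi, rfl⟩ := exists_cycle_offset s
    obtain ⟨k', i', hi', rfl⟩ := exists_cycle_offset s'
    obtain rfl : i = i' := by omega
    have hk : k ≠ k' := fun h => hne (by rw [h])
    rw [e1, e1, cyc_eq, conv_eq _ _ (by omega), conv_eq _ _ (by omega), conv_eq _ _ (by omega),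
      conv_eq _ _ (by omega)]
    interval_cases i <;> simp [sevenCycle_values, Ahead, along, across, convHeight, hk]
  · intro s _ p _ q _ h
    exact (lt_irrefl _ h.2).elim
  · intro s _ p hp
    obtain ⟨q, hq, hmax⟩ := exists_max_along hA.nonempty (cyc s)
    refine ⟨q, hq, rfl, .inl rfl, fun r hr s' _ hh => ?_⟩
    by_cases hb : Beyond (cyc s) (conv s') (conv (s' + 1)) (conv (s + 1))
    · have ho := hh.onSeg
      revert hb ho
      obtain ⟨k, i, hi, rfl⟩ := exists_cycle_offset s
      obtain ⟨k', i', hi', rfl⟩ := exists_cycle_offset s'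
      rw [e1, e1, cyc_eq, conv_eq _ _ (by omega), conv_eq _ _ (by omega), conv_eq _ _ (by omega)]
      interval_cases i <;> interval_cases i' <;>
        simp [sevenCycle_values, Beyond, OnSeg, along, convHeight] <;> omega
    · have h1 := hh.along_le hb
      have h2 := hmax r hr
      rw [along_add_vec] at h1
      omega
  · intro s _ p hp q hq _
    refine Linked.mono ?_ (hA.linked hp hq)
    exact fun r hr => ⟨hr, rfl⟩

/-! ## Flows that build a polyomino -/

/-- A flow that has built the polyomino `P` at time `0`, when it leaves its half plane. -/
structure Flow (P : Finset Cell) (g : Cell → ℤ → Cell) (h S : ℤ) : Prop where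
  valid : Valid {s | s < 0} {s | s ≤ 0} P g
  zero : ∀ p ∈ P, g p 0 = (0, 0)
  one : ∀ p ∈ P, g p 1 = (1, 0)
  left : ∀ p ∈ P, ∀ s ≤ 0, (g p s).1 ≤ 0
  left' : ∀ p ∈ P, ∀ s < 0, s % 7 = 0 → (g p s).1 < 0
  strip : ∀ p ∈ P, ∀ s ≤ 1, -h ≤ (g p s).1 + (g p s).2 ∧ (g p s).1 + (g p s).2 ≤ h
  loose : ∀ s ≤ -S, ∀ p ∈ P, ∀ q ∈ P, p ≠ q → g p s ≠ g q s

/-- A single tile is built by letting it flow. -/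
theorem Flow.single (p : Cell) (hp : IsPolyomino {p}) : Flow {p} (fun _ => conv) 2 0 where
  valid := (conv_valid hp).mono (Set.subset_univ _) (Set.subset_univ _)
  zero _ _ := rfl
  one _ _ := rfl
  left _ _ s hs := by
    unfold conv; split_ifs <;> simp <;> omega
  left' _ _ s hs h := by
    unfold conv; simp [h]; omega
  strip _ _ s hs := by
    unfold conv; split_ifs <;> simp <;> omega
  loose s _ a ha b hb hab := by
    rw [Finset.mem_singleton] at ha hb
    exact (hab (ha.trans hb.symm)).elim

/-! ## Tables of macro positions for two polyominoes -/

instance : DecidableEq Dir := fun a b => by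
  cases a <;> cases b <;> first | exact isTrue rfl | exact isFalse (by simp)

section Table

variable (T : Bool → ℕ → Cell) (n : ℕ)

/-- No segment of token `b` through `w` extends beyond `w` in direction `e`. -/
def Free (b : Bool) (w : Cell) (e : Dir) : Prop :=
  ∀ i < n + 1, OnSeg (T b i) (T b (i + 1)) w → ¬ Beyond e (T b i) (T b (i + 1)) w

instance (b : Bool) (w : Cell) (e : Dir) : Decidable (Free T n b w e) := by
  unfold Free; infer_instance

/-- Token `b` never visits `w`. -/
def Unvisited (b : Bool) (w : Cell) : Prop := ∀ i < n + 1, ¬ OnSeg (T b i) (T b (i + 1)) w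

instance (b : Bool) (w : Cell) : Decidable (Unvisited T n b w) := by
  unfold Unvisited; infer_instance

/-- Token `b` in step `i` and token `b'` in step `i'` do not meet. -/
def ApartAt (i i' : ℕ) (b b' : Bool) : Prop :=
  T b i ≠ T b' i' ∧ (Ahead (sevenCycle i) (T b i) (T b' i') →
    Ahead (sevenCycle i) (T b (i + 1)) (T b' (i' + 1)))

instance (i i' : ℕ) (b b' : Bool) : Decidable (ApartAt T i i' b b') := by
  unfold ApartAt; infer_instance

/-- Token `b` is stopped at the end of step `i` by an obstacle in front of token `c`. -/
def StopAt (dom : Bool → Dir → Bool) (sp : List (ℕ × Bool)) (i : ℕ) (b c : Bool) : Prop :=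
  T c (i + 1) = T b (i + 1) ∧ (T c i = T b i ∨ Ahead (sevenCycle i) (T b i) (T c i)) ∧
    ((i, c) ∈ sp ∨ (∀ b', Free T n b' (T b (i + 1)) (sevenCycle i)) ∧
      (T true i = T false i ∨ dom c (sevenCycle i) = true ∨ Unvisited T n (!c) (T b (i + 1))))

instance (dom : Bool → Dir → Bool) (sp : List (ℕ × Bool)) (i : ℕ) (b c : Bool) :
    Decidable (StopAt T n dom sp i b c) := by
  unfold StopAt; infer_instance

/-- The conditions on a table `T` of the macro positions of two tokens, the token `mv` of which
joins the other one in direction `dj`.  `dom b d` expresses that the polyomino of token `b` extends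
at least as far in direction `d` as the other one, and `sp` lists the stops that are left out. -/
structure TableOK (dj : Dir) (mv : Bool) (dom : Bool → Dir → Bool) (sp : List (ℕ × Bool)) :
    Prop where
  step : ∀ i < n, ∀ b, StepTo (sevenCycle i) (T b i) (T b (i + 1))
  together : ∀ i < n, T true i = T false i → T true (i + 1) = T false (i + 1)
  apart : ∀ i < n, ∀ i' < n, i % 7 = i' % 7 → i ≠ i' → ∀ b b', ApartAt T i i' b b'
  meet : ∀ i < n, ∀ b, Ahead (sevenCycle i) (T b i) (T (!b) i) →
    Ahead (sevenCycle i) (T b (i + 1)) (T (!b) (i + 1)) ∨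
      (T b (i + 1) = T (!b) (i + 1) ∧ sevenCycle i = dj ∧ b = mv)
  halt : ∀ i < n, ∀ b, ∃ c, StopAt T n dom sp i b c
  upper : T true 0 = (0, 10)
  lower : T false 0 = (0, 0)
  cycles : n % 7 = 0 ∧ 0 < n
  right : ∀ b, ∀ i < n + 1, 1 ≤ (T b (i + 1)).1
  final : T true n = T false n
  exit : ∀ b, T b (n + 1) = ((T true n).1 + 1, (T true n).2)
  bound : ∀ b, ∀ i < n + 1, (T b i).1 ≤ (T true n).1
  bound' : ∀ b, ∀ i < n, i % 7 = 0 → (T b i).1 < (T true n).1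

end Table

/-- A table given by two lists. -/
def tableOf (t₁ t₂ : List Cell) (b : Bool) (i : ℕ) : Cell := (if b then t₁ else t₂).getD i (0, 0)

/-- The two polyominoes that the tokens of a table stand for. -/
def side (U L : Finset Cell) (b : Bool) : Finset Cell := if b then U else L

/-- The table settles everything that depends only on the two tokens. What depends on the shapes
enters through three hypotheses: `hNT` for the approach, `hdom` for comparing extents, and `hsp` for
an explicit obstacle at each stop listed in `sp`. -/
theorem TableOK.valid {T : Bool → ℕ → Cell} {n : ℕ} {dj : Dir} {mv : Bool}
    {dom : Bool → Dir → Bool} {sp : List (ℕ × Bool)} (h : TableOK T n dj mv dom sp)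
    {U L : Finset Cell} (hd : Disjoint U L) (hU : IsPolyomino U) (hL : IsPolyomino L)
    (hP : IsPolyomino (U ∪ L))
    (hNT : ∀ p ∈ side U L mv, ∀ q ∈ side U L (!mv), NoTouch dj p q)
    (hdom : ∀ b d, dom b d = true →
      ∀ r ∈ side U L (!b), ∃ q ∈ side U L b, along d r ≤ along d q)
    (hsp : ∀ x ∈ sp, ∃ q ∈ side U L x.2, ∀ b, ∀ r ∈ side U L b, ∃ e,
      Free T n b (T x.2 (x.1 + 1)) e ∧ along e r < along e (q + (sevenCycle x.1).vec)) :
    Valid {s | 0 ≤ s ∧ s < n} {s | 0 ≤ s ∧ s < n + 1} (U ∪ L)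
      (fun p s => T (decide (p ∈ U)) s.toNat) := by
  have side_mem : ∀ p ∈ U ∪ L, p ∈ side U L (decide (p ∈ U)) := by
    intro p hp
    by_cases h : p ∈ U
    · simp [side, h]
    · simpa [side, h] using hp
  have mem_side : ∀ b, ∀ p ∈ side U L b, p ∈ U ∪ L ∧ decide (p ∈ U) = b := by
    rintro (_ | _) p hp
    · simp only [side, Bool.false_eq_true, if_false] at hp
      simp [hp, Finset.disjoint_right.1 hd hp]
    · simp only [side, if_true] at hp
      simp [hp]
  have sidePoly : ∀ b, IsPolyomino (side U L b) := by
    rintro (_ | _)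
    exacts [hL, hU]
  have nat : ∀ s : ℤ, 0 ≤ s → ∃ i : ℕ, s = i := fun s hs => ⟨s.toNat, by omega⟩
  have e1 : ∀ i : ℕ, ((i : ℤ) + 1).toNat = i + 1 := by intro i; omega
  have bcase : ∀ b c : Bool, c = b ∨ c = !b := by decide
  constructor
  · rintro s ⟨hs0, hs⟩ p hp
    obtain ⟨i, rfl⟩ := nat s hs0
    simp only [e1, Int.toNat_natCast, ← sevenCycle_eq_cyc]
    exact h.step i (by omega) _
  · rintro s ⟨hs0, hs⟩ p hp q hq
    obtain ⟨i, rfl⟩ := nat s hs0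
    simp only [e1, Int.toNat_natCast]
    have := h.together i (by omega)
    cases decide (p ∈ U) <;> cases decide (q ∈ U) <;> simp_all
  · rintro s ⟨hs0, hs⟩ s' ⟨hs0', hs'⟩ hm hne p hp q hq
    obtain ⟨i, rfl⟩ := nat s hs0
    obtain ⟨i', rfl⟩ := nat s' hs0'
    simp only [e1, Int.toNat_natCast, ← sevenCycle_eq_cyc]
    exact h.apart i (by omega) i' (by omega) (by omega) (by omega) _ _
  · rintro s ⟨hs0, hs⟩ p hp q hq
    obtain ⟨i, rfl⟩ := nat s hs0
    simp only [e1, Int.toNat_natCast, ← sevenCycle_eq_cyc]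
    have hp' := side_mem p hp
    have hq' := side_mem q hq
    rcases bcase (decide (p ∈ U)) (decide (q ∈ U)) with hb | hb
    · rw [hb]; exact fun ha => (lt_irrefl _ ha.2).elim
    · rw [hb] at hq' ⊢
      intro ha
      refine (h.meet i (by omega) _ ha).imp id fun ⟨h1, h2, h3⟩ => ⟨h1, ?_⟩
      rw [h3] at hp' hq'
      rw [h2]
      exact hNT p hp' q hq'
  · rintro s ⟨hs0, hs⟩ p hp
    obtain ⟨i, rfl⟩ := nat s hs0
    simp only [e1, Int.toNat_natCast, ← sevenCycle_eq_cyc]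
    set b := decide (p ∈ U) with hb
    obtain ⟨c, hc1, hc2, hc3⟩ := h.halt i (by omega) b
    have hfree : ∀ {w : Cell} {x : Cell}, (∀ b', ∀ r ∈ side U L b', ∃ e, Free T n b' w e ∧
        along e r < along e x) → ∀ r ∈ U ∪ L, ∀ s' ∈ {s : ℤ | 0 ≤ s ∧ s < n + 1},
        ¬ Hit (T (decide (r ∈ U)) s'.toNat) (T (decide (r ∈ U)) (s' + 1).toNat) w r x := by
      rintro w x hx r hr s' ⟨hs0', hs'⟩ hh
      obtain ⟨i', rfl⟩ := nat s' hs0'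
      simp only [e1, Int.toNat_natCast] at hh
      obtain ⟨e, he, hlt⟩ := hx _ r (side_mem r hr)
      exact absurd (hh.along_le (he i' (by omega) hh.onSeg)) (by omega)
    -- With only two tokens, if `c` started ahead of `b`, then no tile started behind `b`.
    have late : T c i = T b i ∨ Ahead (sevenCycle i) (T b i) (T c i) ∧ ∀ r ∈ U ∪ L,
        T (decide (r ∈ U)) (i + 1) = T b (i + 1) →
          ¬ Ahead (sevenCycle i) (T (decide (r ∈ U)) i) (T b i) := by
      refine hc2.imp id fun ha => ⟨ha, fun r hr _ ha' => ?_⟩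
      rcases bcase b (decide (r ∈ U)) with h1 | h1
      · rw [h1] at ha'; exact lt_irrefl _ ha'.2
      · rcases bcase b c with h2 | h2
        · rw [h2] at ha; exact lt_irrefl _ ha.2
        · rw [h1, ← h2] at ha'; exact lt_asymm ha.2 ha'.2
    rcases hc3 with hc3 | ⟨hfr, hc3⟩
    · obtain ⟨q, hq, hq'⟩ := hsp _ hc3
      obtain ⟨hqP, hqc⟩ := mem_side c q hq
      refine ⟨q, hqP, by rw [hqc, hc1], by rw [hqc]; exact late, ?_⟩
      rw [hqc]
      exact hfree hq'
    -- The obstacle stands in front of a foremost tile: of the whole union if the tokens travel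
    -- together, otherwise of the side `c`, because that side extends at least as far or because the
    -- other token never comes here.
    · rcases hc3 with hc3 | hc3 | hc3
      · obtain ⟨q, hq, hmax⟩ := exists_max_along hP.nonempty (sevenCycle i)
        have e2 : ∀ c' c'', T c' i = T c'' i := by
          rintro (_ | _) (_ | _) <;> simp [hc3]
        have e3 : ∀ c' c'', T c' (i + 1) = T c'' (i + 1) := by
          have := h.together i (by omega) hc3
          rintro (_ | _) (_ | _) <;> simp [this]
        refine ⟨q, hq, e3 _ _, .inl (e2 _ _), ?_⟩
        rw [e3 (decide (q ∈ U)) b]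
        refine hfree fun b' r hr => ⟨_, hfr b', ?_⟩
        rw [along_add_vec]
        have := hmax r (mem_side _ r hr).1
        omega
      · obtain ⟨q, hq, hmax⟩ := exists_max_along (sidePoly c).nonempty (sevenCycle i)
        obtain ⟨hqP, hqc⟩ := mem_side c q hq
        refine ⟨q, hqP, by rw [hqc, hc1], by rw [hqc]; exact late, ?_⟩
        rw [hqc, hc1]
        refine hfree fun b' r hr => ⟨_, hfr b', ?_⟩
        rw [along_add_vec]
        rcases bcase c b' with rfl | rfl
        · have := hmax r hr
          omega
        · obtain ⟨q', hq', hle⟩ := hdom _ _ hc3 r hr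
          have := hmax q' hq'
          omega
      · obtain ⟨q, hq, hmax⟩ := exists_max_along (sidePoly c).nonempty (sevenCycle i)
        obtain ⟨hqP, hqc⟩ := mem_side c q hq
        refine ⟨q, hqP, by rw [hqc, hc1], by rw [hqc]; exact late, ?_⟩
        rw [hqc, hc1]
        rintro r hr s' ⟨hs0', hs'⟩ hh
        obtain ⟨i', rfl⟩ := nat s' hs0'
        simp only [e1, Int.toNat_natCast] at hh
        rcases bcase c (decide (r ∈ U)) with h1 | h1
        · have hr' := side_mem r hr
          rw [h1] at hr' hh
          have h2 := hh.along_le (hfr _ i' (by omega) hh.onSeg)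
          have h3 := hmax r hr'
          rw [along_add_vec] at h2
          omega
        · rw [h1] at hh
          exact hc3 i' (by omega) hh.onSeg
  · rintro s ⟨hs0, hs⟩ p hp q hq
    obtain ⟨i, rfl⟩ := nat s hs0
    simp only [Int.toNat_natCast]
    intro he
    have hp' := side_mem p hp
    have hq' := side_mem q hq
    by_cases hpq : decide (q ∈ U) = decide (p ∈ U)
    · rw [hpq] at hq'
      refine Linked.mono ?_ ((sidePoly _).linked hp' hq')
      intro r hr
      obtain ⟨h1, h2⟩ := mem_side _ r hr
      exact ⟨h1, by rw [h2]⟩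
    · have : ∀ c', T c' i = T (decide (p ∈ U)) i := by
        intro c'
        revert he hpq
        cases decide (q ∈ U) <;> cases decide (p ∈ U) <;> cases c' <;> simp +contextual
      refine Linked.mono ?_ (hP.linked hp hq)
      exact fun r hr => ⟨hr, this _⟩

/-- The macro rows above `5` are moved up by `H`. -/
def stretch (H y : ℤ) : ℤ := if y < 5 then y else y + H

theorem stretch_strictMono {H : ℤ} (hH : 0 ≤ H) : StrictMono (stretch H) := by
  intro a b hab
  unfold stretch
  split_ifs <;> omega

theorem exists_table_bound (T : Bool → ℕ → Cell) (n : ℕ) (H : ℤ) :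
    ∃ h : ℤ, ∀ b, ∀ i ≤ n, |(T b i).1 + stretch H (T b i).2| ≤ h := by
  obtain ⟨h, hh⟩ := ((Finset.univ ×ˢ Finset.range (n + 1)).image
    fun x : Bool × ℕ => |(T x.1 x.2).1 + stretch H (T x.1 x.2).2|).bddAbove
  refine ⟨h, fun b i hi => hh ?_⟩
  exact Finset.mem_coe.2 (Finset.mem_image.2 ⟨(b, i), by simp; omega, rfl⟩)

/-- Two flows are combined into one according to a valid table. -/
theorem Flow.join {T : Bool → ℕ → Cell} {n : ℕ} {dj : Dir} {mv : Bool}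
    {dom : Bool → Dir → Bool} {sp : List (ℕ × Bool)} (hT : TableOK T n dj mv dom sp)
    {U L : Finset Cell} (hd : Disjoint U L)
    (hV : Valid {s | 0 ≤ s ∧ s < n} {s | 0 ≤ s ∧ s < n + 1} (U ∪ L)
      (fun p s => T (decide (p ∈ U)) s.toNat))
    {gU gL : Cell → ℤ → Cell} {hU SU hL SL : ℤ} (fU : Flow U gU hU SU) (fL : Flow L gL hL SL) :
    ∃ g h S, Flow (U ∪ L) g h S := by
  classical
  -- The upper flow ends in row `H + 10`, so its strip begins at `H + 10 - hU`, which must lie above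
  -- `hL`.
  obtain ⟨H, hH0, hHU, hHL⟩ : ∃ H : ℤ, 0 ≤ H ∧ hL < H + 10 - hU ∧ 0 ≤ hL + H :=
    ⟨|hU| + |hL|, by positivity, by linarith [le_abs_self hU, le_abs_self hL],
      by linarith [abs_nonneg hU, neg_abs_le hL]⟩
  have hψ := stretch_strictMono hH0
  obtain ⟨g, hg⟩ : ∃ g : Cell → ℤ → Cell, ∀ p s, g p s =
      if 0 ≤ s then relabel id (stretch H) (T (decide (p ∈ U)) s.toNat)
      else if p ∈ U then relabel id (· + (H + 10)) (gU p s) else gL p s := ⟨_, fun _ _ => rfl⟩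
  have hLU : ∀ p ∈ L, p ∉ U := fun p hp => Finset.disjoint_right.1 hd hp
  have gpos : ∀ p, ∀ i : ℕ, g p i = relabel id (stretch H) (T (decide (p ∈ U)) i) := by
    intro p i; rw [hg]; simp
  have gnegU : ∀ p ∈ U, ∀ s ≤ 0, g p s = ((gU p s).1, (gU p s).2 + (H + 10)) := by
    intro p hp s hs
    rcases eq_or_lt_of_le hs with rfl | hs
    · rw [hg, fU.zero p hp]
      simp [hp, hT.upper, relabel, stretch]; ring
    · rw [hg, if_neg (by omega), if_pos hp]; rfl
  have gnegL : ∀ p ∈ L, ∀ s ≤ 0, g p s = gL p s := by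
    intro p hp s hs
    rcases eq_or_lt_of_le hs with rfl | hs
    · rw [hg, fL.zero p hp]
      simp [hLU p hp, hT.lower, relabel, stretch]
    · rw [hg, if_neg (by omega), if_neg (hLU p hp)]
  -- Truncating the step at time `0` in column `1` makes the trajectories agree with the two given
  -- flows up to time `1`.
  set g' : Cell → ℤ → Cell := fun p s => if s ≤ 0 then g p s else (1, (g p 0).2) with hg'
  have gU' : ∀ p ∈ U, ∀ s ≤ 1, g' p s = relabel id (· + (H + 10)) (gU p s) := by
    intro p hp s hs
    by_cases h : s ≤ 0
    · simp only [hg', h, if_true]; rw [gnegU p hp s h]; rfl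
    · obtain rfl : s = 1 := by omega
      simp only [hg', h, if_false]; rw [gnegU p hp 0 le_rfl, fU.zero p hp, fU.one p hp]; rfl
  have gL' : ∀ p ∈ L, ∀ s ≤ 1, g' p s = gL p s := by
    intro p hp s hs
    by_cases h : s ≤ 0
    · simp only [hg', h, if_true]; rw [gnegL p hp s h]
    · obtain rfl : s = 1 := by omega
      simp only [hg', h, if_false]; rw [gnegL p hp 0 le_rfl, fL.zero p hp, fL.one p hp]
  have stripU : ∀ p ∈ U, ∀ s ≤ 1, hL < (g' p s).1 + (g' p s).2 := by
    intro p hp s hs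
    rw [gU' p hp s hs]
    have := fU.strip p hp s hs
    simp only [relabel, id]
    omega
  have stripL : ∀ p ∈ L, ∀ s ≤ 1, (g' p s).1 + (g' p s).2 ≤ hL := by
    intro p hp s hs
    rw [gL' p hp s hs]
    exact (fL.strip p hp s hs).2
  have hold : Valid {s | s < 0} {s | s ≤ 0} (U ∪ L) g' := by
    have c1 : ∀ s : ℤ, s ∈ ({s | s < 0} : Set ℤ) → s ≤ 0 := fun s (hs : s < 0) => hs.le
    have c2 : ∀ s : ℤ, s ∈ ({s | s ≤ 0} : Set ℤ) → s ≤ 0 := fun s hs => hs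
    have c3 : ∀ s : ℤ, s ∈ ({s | s < 0} ∪ {s | s ≤ 0} : Set ℤ) → s ≤ 0 :=
      fun s hs => hs.elim (c1 s) (c2 s)
    have vU : Valid {s | s < 0} {s | s ≤ 0} U g' := by
      refine (fU.valid.relabel strictMono_id
        (show StrictMono fun y : ℤ => y + (H + 10) from fun a b h => by simpa using h)).congr ?_ ?_
      · exact fun p hp s hs => ⟨gU' p hp s (by have := c1 s hs; omega),
          gU' p hp (s + 1) (by have := c1 s hs; omega)⟩
      · exact fun p hp s hs => ⟨gU' p hp s (by have := c2 s hs; omega),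
          gU' p hp (s + 1) (by have := c2 s hs; omega)⟩
    have vL : Valid {s | s < 0} {s | s ≤ 0} L g' := by
      refine fL.valid.congr ?_ ?_
      · exact fun p hp s hs => ⟨gL' p hp s (by have := c1 s hs; omega),
          gL' p hp (s + 1) (by have := c1 s hs; omega)⟩
      · exact fun p hp s hs => ⟨gL' p hp s (by have := c2 s hs; omega),
          gL' p hp (s + 1) (by have := c2 s hs; omega)⟩
    refine vU.union vL (h := hL) ?_ ?_ ?_
    · exact fun p hp s hs => ⟨stripU p hp s (by have := c3 s hs; omega),
        stripU p hp (s + 1) (by have := c3 s hs; omega)⟩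
    · exact fun p hp s hs => ⟨stripL p hp s (by have := c3 s hs; omega),
        stripL p hp (s + 1) (by have := c3 s hs; omega)⟩
    · intro s hs p hp
      rcases eq_or_lt_of_le (c2 s hs) with rfl | h
      · rw [cyc_eq_right rfl, zero_add]
        rcases Finset.mem_union.1 hp with hp | hp
        · rw [gU' p hp 0 (by omega), gU' p hp 1 le_rfl, fU.zero p hp, fU.one p hp]
          simp [StepTo, across, along, relabel]
        · rw [gL' p hp 0 (by omega), gL' p hp 1 le_rfl, fL.zero p hp, fL.one p hp]
          simp [StepTo, across, along]
      · rcases Finset.mem_union.1 hp with hp | hp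
        exacts [vU.step s h p hp, vL.step s h p hp]
  have hnpos := hT.cycles.2
  have hn7 := hT.cycles.1
  have nat : ∀ s : ℤ, 0 ≤ s → ∃ i : ℕ, s = i := fun s hs => ⟨s.toNat, by omega⟩
  have leftU : ∀ p ∈ U ∪ L, ∀ s ≤ 0, (g p s).1 ≤ 0 := by
    intro p hp s hs
    rcases Finset.mem_union.1 hp with hp | hp
    · rw [gnegU p hp s hs]; exact fU.left p hp s hs
    · rw [gnegL p hp s hs]; exact fL.left p hp s hs
  have leftU' : ∀ p ∈ U ∪ L, ∀ s < 0, s % 7 = 0 → (g p s).1 < 0 := by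
    intro p hp s hs hm
    rcases Finset.mem_union.1 hp with hp | hp
    · rw [gnegU p hp s hs.le]; exact fU.left' p hp s hs hm
    · rw [gnegL p hp s hs.le]; exact fL.left' p hp s hs hm
  have hfull : Valid {s | 0 ≤ s → s ∈ {s : ℤ | s < n}} {s | 0 ≤ s → s ∈ {s : ℤ | s < n + 1}}
      (U ∪ L) g := by
    refine Valid.glue hold ?_ (by simpa using hnpos) leftU leftU' ?_ ?_
    · refine (hV.relabel strictMono_id hψ).congr ?_ ?_
      · rintro p hp s ⟨hs, -⟩
        simp [hg, hs, show 0 ≤ s + 1 by omega]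
      · rintro p hp s ⟨hs, -⟩
        simp [hg, hs, show 0 ≤ s + 1 by omega]
    · intro p hp
      rcases Finset.mem_union.1 hp with hp | hp
      · rw [gnegU p hp 0 le_rfl, fU.zero p hp]
      · rw [gnegL p hp 0 le_rfl, fL.zero p hp]
    · intro p hp s hs
      have hs : s < n + 1 := by
        rcases hs with hs | hs
        · have : s < n := hs
          omega
        · exact hs
      constructor
      · intro h
        obtain ⟨i, rfl⟩ := nat (s - 1) (by omega) |>.imp fun i hi => (by omega : s = (i + 1 : ℕ))
        rw [gpos]
        exact hT.right _ i (by omega)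
      · intro h
        obtain ⟨i, rfl⟩ := nat s h
        rw [show (i : ℤ) + 1 = ((i + 1 : ℕ) : ℤ) by push_cast; rfl, gpos]
        exact hT.right _ i (by omega)
  obtain ⟨hB, hhB⟩ := exists_table_bound T (n + 1) H
  set v := T true n with hv
  have fin : ∀ b, T b n = v := by
    rintro (_ | _)
    exacts [hT.final.symm, rfl]
  have gn : ∀ p, g p n = relabel id (stretch H) v := by
    intro p; rw [gpos, fin]
  have gn1 : ∀ p, g p (n + 1) = (v.1 + 1, stretch H v.2) := by
    intro p
    rw [show (n : ℤ) + 1 = ((n + 1 : ℕ) : ℤ) by push_cast; rfl, gpos, hT.exit]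
    rfl
  have vpos : 1 ≤ v.1 := by
    have := hT.right true (n - 1) (by omega)
    rwa [Nat.sub_add_cancel hnpos] at this
  obtain ⟨k, hk⟩ : ∃ k : ℤ, 7 * k = n := ⟨n / 7, by omega⟩
  have mono1 : StrictMono fun x : ℤ => x - v.1 := fun a b h => by simpa using h
  have mono2 : StrictMono fun y : ℤ => y - stretch H v.2 := fun a b h => by simpa using h
  obtain ⟨M, hM1, hM2, hM3⟩ : ∃ M : ℤ, hB ≤ M ∧ |hU| + H + 10 ≤ M ∧ |hL| ≤ M :=
    ⟨max hB (max (|hU| + H + 10) |hL|), by simp, by simp, by simp⟩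
  -- Time is shifted by the whole cycles of the table and the final vertex is moved to the origin.
  -- The tiles are loose before both given flows start to join theirs, `n` steps earlier on the new
  -- clock.
  refine ⟨fun p s => relabel (· - v.1) (· - stretch H v.2) (g p (s + 7 * k)),
    M + |v.1 + stretch H v.2|, max (max SU SL) 0 + n, ?_⟩
  constructor
  · refine ((hfull.shift k).relabel mono1 mono2).mono ?_ ?_
    · intro s (hs : s < 0) _
      show s + 7 * k < n
      omega
    · intro s (hs : s ≤ 0) _
      show s + 7 * k < n + 1
      omega
  · intro p hp
    simp only [hk, zero_add, gn, relabel, id, sub_self]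
  · intro p hp
    simp only [hk, add_comm (1 : ℤ), gn1, relabel, sub_self]
    simp
  · intro p hp s hs
    simp only [hk, relabel]
    rcases lt_or_ge (s + n) 0 with h | h
    · have := leftU p hp (s + n) h.le
      omega
    · obtain ⟨i, hi⟩ := nat _ h
      rw [hi, gpos]
      have := hT.bound (decide (p ∈ U)) i (by omega)
      rw [← hv] at this
      simp only [relabel, id]
      omega
  · intro p hp s hs hm
    simp only [hk, relabel]
    rcases lt_or_ge (s + n) 0 with h | h
    · have := leftU p hp (s + n) h.le
      omega
    · obtain ⟨i, hi⟩ := nat _ h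
      rw [hi, gpos]
      have := hT.bound' (decide (p ∈ U)) i (by omega) (by omega)
      rw [← hv] at this
      simp only [relabel, id]
      omega
  · intro p hp s hs
    have key : |(g p (s + n)).1 + (g p (s + n)).2| ≤ M := by
      rcases lt_or_ge (s + n) 0 with h | h
      · rcases Finset.mem_union.1 hp with hp | hp
        · rw [gnegU p hp _ h.le]
          have := fU.strip p hp _ (by omega : s + n ≤ 1)
          have h1 := le_abs_self hU
          rw [abs_le]
          constructor <;> simp only <;> omega
        · rw [gnegL p hp _ h.le]
          have := fL.strip p hp _ (by omega : s + n ≤ 1)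
          have h1 := le_abs_self hL
          rw [abs_le]
          constructor <;> omega
      · obtain ⟨i, hi⟩ := nat _ h
        rw [hi, gpos]
        exact (hhB _ i (by omega)).trans hM1
    simp only [hk, relabel]
    rw [abs_le] at key
    have h1 := le_abs_self (v.1 + stretch H v.2)
    have h2 := neg_abs_le (v.1 + stretch H v.2)
    constructor <;> omega
  · intro s hs p hp q hq hpq
    simp only [hk]
    rw [Ne, relabel_inj mono1 mono2]
    have h0 : s + n ≤ 0 := by omega
    have hsU : s + n ≤ -SU := by omega
    have hsL : s + n ≤ -SL := by omega
    have eg : ∀ r, g r (s + n) = g' r (s + n) := fun r => by simp [hg', h0]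
    have cross : ∀ r ∈ U, ∀ t ∈ L, g r (s + n) ≠ g t (s + n) := by
      intro r hr t ht e
      have h1 := stripU r hr (s + n) (by omega)
      have h2 := stripL t ht (s + n) (by omega)
      rw [← eg] at h1 h2
      rw [e] at h1
      omega
    rcases Finset.mem_union.1 hp with hp | hp <;> rcases Finset.mem_union.1 hq with hq | hq
    · rw [gnegU p hp _ h0, gnegU q hq _ h0]
      intro e
      refine fU.loose _ hsU p hp q hq hpq ?_
      simpa [Prod.ext_iff] using e
    · exact cross p hp q hq
    · exact (cross q hq p hp).symm
    · rw [gnegL p hp _ h0, gnegL q hq _ h0]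
      exact fL.loose _ hsL p hp q hq hpq

/-! ## Relative positions of the two parts of a cut -/

theorem along_add_smul (d : Dir) (q : Cell) (k : ℕ) : along d (q + k • d.vec) = along d q + k := by
  cases d <;> simp [along, Dir.vec] <;> ring

theorem across_add_smul (d : Dir) (q : Cell) (k : ℕ) : across d (q + k • d.vec) = across d q := by
  cases d <;> simp [across, Dir.vec]

theorem eq_of_along_across {d : Dir} {p q : Cell} (h₁ : along d p = along d q)
    (h₂ : across d p = across d q) : p = q := by
  cases d <;> simp only [along, across] at h₁ h₂ <;> ext <;> omega

theorem CanPullApart.noTouch {d : Dir} {A B : Finset Cell} (h : CanPullApart d A B) {p q : Cell}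
    (hp : p ∈ B) (hq : q ∈ A) : NoTouch d p q := fun k hk =>
  ⟨fun e => (h k hk q hq p hp).1 e.symm, fun hc => (h k hk q hq p hp).2 ⟨hc.1.symm, hc.2.symm⟩⟩

theorem CanPullApart.noTouch' {d d' : Dir} (hd : d'.vec = -d.vec) {A B : Finset Cell}
    (h : CanPullApart d A B) {p q : Cell} (hp : p ∈ A) (hq : q ∈ B) : NoTouch d' p q := by
  intro k hk
  obtain ⟨h1, h2⟩ := h k hk p hp q hq
  rw [hd]
  refine ⟨fun e => h1 ?_, fun hc => h2 ⟨hc.1, ?_⟩⟩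
  · rw [e]; simp
  · have := hc.2
    simp only [gridGraph, Prod.fst_add, Prod.snd_add, Prod.smul_fst, Prod.smul_snd, Prod.fst_neg,
      Prod.snd_neg, smul_neg] at this ⊢
    rw [← this]
    congr 2 <;> ring

/-- On a line parallel to `d`, the tiles of `A` lie beyond those of `B`. -/
theorem CanPullApart.along_lt {d : Dir} {A B : Finset Cell} (h : CanPullApart d A B)
    (hd : Disjoint A B) {a b : Cell} (ha : a ∈ A) (hb : b ∈ B) (hab : across d a = across d b) :
    along d b < along d a := by
  by_contra! hlt
  obtain ⟨k, hk⟩ : ∃ k : ℕ, along d a + k = along d b := ⟨(along d b - along d a).toNat, by omega⟩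
  rcases Nat.eq_zero_or_pos k with rfl | hpos
  · refine Finset.disjoint_left.1 hd ha ?_
    rw [eq_of_along_across (by simpa using hk) hab]
    exact hb
  · refine (h k hpos a ha b hb).1 (eq_of_along_across (d := d) ?_ ?_)
    · rw [along_add_smul, hk]
    · rw [across_add_smul, hab]

/-- `A` extends at least as far as `B` in direction `d`. -/
def Extends (d : Dir) (A B : Finset Cell) : Prop := ∀ r ∈ B, ∃ q ∈ A, along d r ≤ along d q

/-- A tile that is extreme in direction `e` and, among those, in direction `d`. -/
theorem exists_corner {S : Finset Cell} (h : S.Nonempty) (e d : Dir) :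
    ∃ q ∈ S, ∀ r ∈ S, along e r < along e q ∨ (along e r = along e q ∧ along d r ≤ along d q) := by
  obtain ⟨q₀, hq₀, hmax⟩ := exists_max_along h e
  obtain ⟨q, hq, hmax'⟩ := exists_max_along
    (P := S.filter fun r => along e r = along e q₀) ⟨q₀, by simp [hq₀]⟩ d
  rw [Finset.mem_filter] at hq
  refine ⟨q, hq.1, fun r hr => ?_⟩
  rcases lt_or_eq_of_le (hmax r hr) with h1 | h1
  · left; rw [hq.2]; exact h1
  · right; exact ⟨by rw [hq.2, h1], hmax' r (by simp [hr, h1])⟩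

theorem lt_along_add_vec {d : Dir} {r q : Cell} (h : along d r ≤ along d q) :
    along d r < along d (q + d.vec) := by
  rw [along_add_vec]; omega

/-! ## Joining two polyominoes vertically -/

section Vertical

variable {U L : Finset Cell} {gU gL : Cell → ℤ → Cell} {hU SU hL SL : ℤ}

/-- Macro positions if the upper polyomino does not extend further to the left. -/
def dropTable : Bool → ℕ → Cell := tableOf
  [(0, 10), (2, 10), (2, 11), (2, 10), (2, 11), (2, 11), (1, 11), (1, -1),
    (3, -1), (3, 0), (3, -2), (3, 0), (3, 0), (3, 0), (3, -2), (4, -2)]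
  [(0, 0), (2, 0), (2, 1), (2, 0), (2, 1), (2, 1), (1, 1), (1, -1),
    (3, -1), (3, 0), (3, -2), (3, 0), (3, 0), (3, 0), (3, -2), (4, -2)]

theorem dropTable_ok :
    TableOK dropTable 14 .down true (fun b d => b = false ∧ d = .left) [(6, false)] := by
  constructor
  all_goals decide +kernel

/-- The upper part falls through `(1, 1)`, where the lower part was stopped from the left, and lands
at `(1, -1)`. Neither obstacle is in its way, as it does not extend further to the left. -/
theorem Flow.drop (hd : Disjoint U L) (pU : IsPolyomino U) (pL : IsPolyomino L)
    (pP : IsPolyomino (U ∪ L)) (hc : CanPullApart .up U L) (hx : Extends .left L U)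
    (fU : Flow U gU hU SU) (fL : Flow L gL hL SL) : ∃ g h S, Flow (U ∪ L) g h S := by
  refine Flow.join dropTable_ok hd (dropTable_ok.valid hd pU pL pP ?_ ?_ ?_) fU fL
  · exact fun p hp q hq => hc.noTouch' (by simp [Dir.vec]) hp hq
  · intro b d hbd
    obtain ⟨rfl, rfl⟩ := of_decide_eq_true hbd
    exact hx
  · intro x h
    rw [List.mem_singleton] at h
    subst h
    have free : ∀ b, Free dropTable 14 b (dropTable false 7) .left ∧
      Free dropTable 14 b (dropTable false 7) .down := by decide +kernel
    obtain ⟨q, hq, hmax⟩ := exists_corner pL.nonempty .left .down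
    refine ⟨q, hq, fun b r hr => ?_⟩
    -- The obstacle goes below a leftmost tile of `L`, the lowest one of its column. A tile of `U`
    -- in that column lies above it by the cut condition.
    have key : along .left r < along .left q ∨
        along .left r = along .left q ∧ along .down r ≤ along .down q := by
      cases b
      · exact hmax r hr
      · obtain ⟨q', hq', hle⟩ := hx r hr
        have h1 := hmax q' hq'
        have h2 : across .up r = across .up q → _ := hc.along_lt hd hr hq
        simp only [along, across] at *
        omega
    rcases key with h | ⟨-, h⟩
    · exact ⟨.left, (free b).1, by
        rw [sevenCycle_values.2.2.2.2.2.2]; simpa [along, Dir.vec] using h⟩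
    · exact ⟨.down, (free b).2, lt_along_add_vec h⟩

/-- Macro positions if the lower polyomino extends further to the right. -/
def landTable : Bool → ℕ → Cell := tableOf
  [(0, 10), (2, 10), (2, 10), (2, -1), (2, 2), (2, 2), (1, 2), (1, -2),
    (3, -2), (3, -1), (3, -3), (3, -1), (3, -1), (3, -1), (3, -3), (4, -3)]
  [(0, 0), (2, 0), (2, 2), (2, -1), (2, 2), (2, 2), (1, 2), (1, -2),
    (3, -2), (3, -1), (3, -3), (3, -1), (3, -1), (3, -1), (3, -3), (4, -3)]

theorem landTable_ok : TableOK landTable 14 .down true (fun b d => b = false ∧ d = .right)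
    [(1, false), (2, false), (3, false)] := by
  constructor
  all_goals decide +kernel

theorem not_extends {d : Dir} {A B : Finset Cell} (h : ¬ Extends d A B) :
    ∃ r ∈ B, ∀ q ∈ A, along d q < along d r := by
  simpa [Extends] using h

/-- The upper part falls through `(2, 2)`, where the lower part stops when it moves up. The obstacle
above a rightmost tile of `L` is out of reach for every tile of `U`. -/
theorem Flow.land (hd : Disjoint U L) (pU : IsPolyomino U) (pL : IsPolyomino L)
    (pP : IsPolyomino (U ∪ L)) (hc : CanPullApart .up U L) (hx : ¬ Extends .right U L)
    (fU : Flow U gU hU SU) (fL : Flow L gL hL SL) : ∃ g h S, Flow (U ∪ L) g h S := by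
  obtain ⟨r₀, hr₀, hlt⟩ := not_extends hx
  refine Flow.join landTable_ok hd (landTable_ok.valid hd pU pL pP ?_ ?_ ?_) fU fL
  · exact fun p hp q hq => hc.noTouch' (by simp [Dir.vec]) hp hq
  · intro b d hbd
    obtain ⟨rfl, rfl⟩ := of_decide_eq_true hbd
    exact fun r hr => ⟨r₀, hr₀, (hlt r hr).le⟩
  · have top : ∃ q ∈ side U L false, ∀ b, ∀ r ∈ side U L b, ∃ e,
        Free landTable 14 b (2, 2) e ∧ along e r < along e (q + Dir.up.vec) := by
      have free : ∀ b, Free landTable 14 b (2, 2) .right := by decide +kernel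
      have free' : Free landTable 14 false (2, 2) .up := by decide +kernel
      obtain ⟨q, hq, hmax⟩ := exists_corner pL.nonempty .right .up
      refine ⟨q, hq, fun b r hr => ?_⟩
      cases b
      · rcases hmax r hr with h | ⟨-, h⟩
        · exact ⟨.right, free _, by simpa [along, Dir.vec] using h⟩
        · exact ⟨.up, free', lt_along_add_vec h⟩
      · refine ⟨.right, free _, ?_⟩
        have h1 := hmax r₀ hr₀
        have h2 := hlt r hr
        simp only [along, Dir.vec, Prod.fst_add] at *
        omega
    -- The tokens use `(2, -1)` only from above, so the cell below the lowest tile of `L` is safe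
    -- from other columns; in its own column, `U` lies above `L`.
    have bottom : ∃ q ∈ side U L false, ∀ b, ∀ r ∈ side U L b, ∃ e,
        Free landTable 14 b (2, -1) e ∧ along e r < along e (q + Dir.down.vec) := by
      have free : ∀ b, Free landTable 14 b (2, -1) .right ∧ Free landTable 14 b (2, -1) .left ∧
        Free landTable 14 b (2, -1) .down := by decide +kernel
      obtain ⟨q, hq, hmax⟩ := exists_max_along pL.nonempty .down
      refine ⟨q, hq, fun b r hr => ?_⟩
      cases b
      · exact ⟨.down, (free _).2.2, lt_along_add_vec (hmax r hr)⟩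
      · rcases lt_trichotomy r.1 q.1 with h | h | h
        · exact ⟨.right, (free _).1, by simpa [along, Dir.vec] using h⟩
        · refine ⟨.down, (free _).2.2, lt_along_add_vec ?_⟩
          have := hc.along_lt hd hr hq h
          simp only [along] at *
          omega
        · exact ⟨.left, (free _).2.1, by simpa [along, Dir.vec] using h⟩
    intro x h
    simp only [List.mem_cons, List.not_mem_nil, or_false] at h
    rcases h with rfl | rfl | rfl
    exacts [top, bottom, top]

/-- Macro positions if the upper polyomino extends further to the left and not less far to the
right. -/
def liftTable : Bool → ℕ → Cell := tableOf
  [(0, 10), (2, 10), (2, 12), (2, 8), (2, 12), (2, 12), (2, 12), (2, 8), (3, 8)]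
  [(0, 0), (2, 0), (2, 12), (2, 8), (2, 12), (2, 12), (2, 12), (2, 8), (3, 8)]

theorem liftTable_ok : TableOK liftTable 7 .up false (fun b d => b = true ∧ d = .right)
    [(1, true), (2, true), (6, true)] := by
  constructor
  all_goals decide +kernel

/-- Here the lower part rises to the upper one. On its way it passes `(2, 10)`, where `U` was
stopped from the right, and `(2, 8)`, where the joined polyomino will stop on its way down. The
latter obstacle stands below a leftmost tile of `U`, which `L` does not reach. -/
theorem Flow.lift (hd : Disjoint U L) (pU : IsPolyomino U) (pL : IsPolyomino L)
    (pP : IsPolyomino (U ∪ L)) (hc : CanPullApart .up U L) (hx : Extends .right U L)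
    (hx' : ¬ Extends .left L U) (fU : Flow U gU hU SU) (fL : Flow L gL hL SL) :
    ∃ g h S, Flow (U ∪ L) g h S := by
  obtain ⟨r₀, hr₀, hlt⟩ := not_extends hx'
  refine Flow.join liftTable_ok hd (liftTable_ok.valid hd pU pL pP ?_ ?_ ?_) fU fL
  · exact fun p hp q hq => hc.noTouch hp hq
  · intro b d hbd
    obtain ⟨rfl, rfl⟩ := of_decide_eq_true hbd
    exact hx
  · have top : ∃ q ∈ side U L true, ∀ b, ∀ r ∈ side U L b, ∃ e,
        Free liftTable 7 b (2, 12) e ∧ along e r < along e (q + Dir.up.vec) := by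
      have free : ∀ b, Free liftTable 7 b (2, 12) .right ∧ Free liftTable 7 b (2, 12) .left ∧
        Free liftTable 7 b (2, 12) .up := by decide +kernel
      obtain ⟨q, hq, hmax⟩ := exists_max_along pU.nonempty .up
      refine ⟨q, hq, fun b r hr => ?_⟩
      cases b
      · rcases lt_trichotomy r.1 q.1 with h | h | h
        · exact ⟨.right, (free _).1, by simpa [along, Dir.vec] using h⟩
        · exact ⟨.up, (free _).2.2, lt_along_add_vec (hc.along_lt hd hq hr h.symm).le⟩
        · exact ⟨.left, (free _).2.1, by simpa [along, Dir.vec] using h⟩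
      · exact ⟨.up, (free _).2.2, lt_along_add_vec (hmax r hr)⟩
    have bottom : ∃ q ∈ side U L true, ∀ b, ∀ r ∈ side U L b, ∃ e,
        Free liftTable 7 b (2, 8) e ∧ along e r < along e (q + Dir.down.vec) := by
      have free : ∀ b, Free liftTable 7 b (2, 8) .left := by decide +kernel
      have free' : Free liftTable 7 true (2, 8) .down := by decide +kernel
      obtain ⟨q, hq, hmax⟩ := exists_corner pU.nonempty .left .down
      refine ⟨q, hq, fun b r hr => ?_⟩
      cases b
      · refine ⟨.left, free _, ?_⟩
        have h1 := hmax r₀ hr₀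
        have h2 := hlt r hr
        simp only [along, Dir.vec, Prod.fst_add] at *
        omega
      · rcases hmax r hr with h | ⟨-, h⟩
        · exact ⟨.left, free _, by simpa [along, Dir.vec] using h⟩
        · exact ⟨.down, free', lt_along_add_vec h⟩
    intro x h
    simp only [List.mem_cons, List.not_mem_nil, or_false] at h
    rcases h with rfl | rfl | rfl
    exacts [top, bottom, bottom]

/-- The three cases are exhaustive: the lower part extends strictly further right, or it does not
and then either extends at least as far left or not. -/
theorem Flow.vertical (hd : Disjoint U L) (pU : IsPolyomino U) (pL : IsPolyomino L)
    (pP : IsPolyomino (U ∪ L)) (hc : CanPullApart .up U L)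
    (fU : Flow U gU hU SU) (fL : Flow L gL hL SL) : ∃ g h S, Flow (U ∪ L) g h S := by
  by_cases hx : Extends .right U L
  · by_cases hx' : Extends .left L U
    · exact Flow.drop hd pU pL pP hc hx' fU fL
    · exact Flow.lift hd pU pL pP hc hx hx' fU fL
  · exact Flow.land hd pU pL pP hc hx fU fL

end Vertical

/-! ## Joining two polyominoes horizontally -/

section Horizontal

variable {A B : Finset Cell} {gA gB : Cell → ℤ → Cell} {hA SA hB SB : ℤ}

/-- Macro positions if the left polyomino extends further upwards. -/
def hookTable : Bool → ℕ → Cell := tableOf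
  [(0, 10), (2, 10), (2, 11), (2, 10), (2, 11), (2, 11), (1, 11), (1, -1),
    (4, -1), (4, 0), (4, -2), (4, 0), (4, 0), (4, 0), (4, -2), (5, -2)]
  [(0, 0), (3, 0), (3, 11), (3, 0), (3, 11), (3, 11), (1, 11), (1, -1),
    (4, -1), (4, 0), (4, -2), (4, 0), (4, 0), (4, 0), (4, -2), (5, -2)]

theorem hookTable_ok : TableOK hookTable 14 .left false (fun b d => b = true ∧ d = .up)
    [(4, true), (5, true)] := by
  constructor
  all_goals decide +kernel

/-- The right part moves left across `(2, 11)`, where the left part had stopped, and catches up with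
it at `(1, 11)`. The stops of the left part use a topmost tile of `A`, whose row lies above all of
`B`. -/
theorem Flow.hook (hd : Disjoint A B) (pA : IsPolyomino A) (pB : IsPolyomino B)
    (pP : IsPolyomino (A ∪ B)) (hc : CanPullApart .right B A) (hx : ¬ Extends .up B A)
    (fA : Flow A gA hA SA) (fB : Flow B gB hB SB) : ∃ g h S, Flow (A ∪ B) g h S := by
  obtain ⟨r₀, hr₀, hlt⟩ := not_extends hx
  refine Flow.join hookTable_ok hd (hookTable_ok.valid hd pA pB pP ?_ ?_ ?_) fA fB
  · exact fun p hp q hq => hc.noTouch' (by simp [Dir.vec]) hp hq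
  · intro b d hbd
    obtain ⟨rfl, rfl⟩ := of_decide_eq_true hbd
    exact fun r hr => ⟨r₀, hr₀, (hlt r hr).le⟩
  · have gen : ∀ d : Dir, d = .right ∨ d = .left → ∀ w : Cell,
        (∀ b, Free hookTable 14 b w .up) → Free hookTable 14 true w d →
        ∃ q ∈ side A B true, ∀ b, ∀ r ∈ side A B b, ∃ e,
          Free hookTable 14 b w e ∧ along e r < along e (q + d.vec) := by
      intro d hdir w free free'
      have e1 : ∀ q : Cell, along .up (q + d.vec) = along .up q := by
        rcases hdir with rfl | rfl <;> simp [along, Dir.vec]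
      obtain ⟨q, hq, hmax⟩ := exists_corner pA.nonempty .up d
      refine ⟨q, hq, fun b r hr => ?_⟩
      cases b
      · refine ⟨.up, free _, ?_⟩
        have h1 := hmax r₀ hr₀
        have h2 := hlt r hr
        rw [e1]
        omega
      · rcases hmax r hr with h | ⟨-, h⟩
        · exact ⟨.up, free _, by rwa [e1]⟩
        · exact ⟨d, free', lt_along_add_vec h⟩
    intro x h
    simp only [List.mem_cons, List.not_mem_nil, or_false] at h
    rcases h with rfl | rfl
    · exact gen .right (.inl rfl) _ (by decide +kernel) (by decide +kernel)
    · exact gen .left (.inr rfl) _ (by decide +kernel) (by decide +kernel)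

/-- A stopping place of the right polyomino, at which the left one joins it. -/
theorem stop_of_pull_right {T : Bool → ℕ → Cell} {n : ℕ} {w : Cell} (hd : Disjoint A B)
    (pB : IsPolyomino B) (hc : CanPullApart .right B A)
    (free : ∀ b, Free T n b w .right ∧ Free T n b w .up ∧ Free T n b w .down) :
    ∃ q ∈ side A B false, ∀ b, ∀ r ∈ side A B b, ∃ e,
      Free T n b w e ∧ along e r < along e (q + Dir.right.vec) := by
  obtain ⟨q, hq, hmax⟩ := exists_max_along pB.nonempty .right
  refine ⟨q, hq, fun b r hr => ?_⟩
  cases b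
  · exact ⟨.right, (free _).1, lt_along_add_vec (hmax r hr)⟩
  -- A tile of `A` in another row never leaves that row at this vertex; one in the row of `q` lies
  -- to the left of `q` by the cut condition.
  · rcases lt_trichotomy r.2 q.2 with h | h | h
    · exact ⟨.up, (free _).2.1, by simpa [along, Dir.vec] using h⟩
    · exact ⟨.right, (free _).1, lt_along_add_vec (hc.along_lt hd.symm hq hr h.symm).le⟩
    · exact ⟨.down, (free _).2.2, by simpa [along, Dir.vec] using h⟩

/-- Macro positions if the right polyomino extends further upwards. -/
def pushTable : Bool → ℕ → Cell := tableOf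
  [(0, 10), (1, 10), (1, 11), (1, 10), (1, 11), (4, 11), (2, 11), (2, -1),
    (5, -1), (5, 0), (5, -2), (5, 0), (5, 0), (5, 0), (5, -2), (6, -2)]
  [(0, 0), (3, 0), (3, 11), (3, 0), (3, 11), (4, 11), (2, 11), (2, -1),
    (5, -1), (5, 0), (5, -2), (5, 0), (5, 0), (5, 0), (5, -2), (6, -2)]

theorem pushTable_ok : TableOK pushTable 14 .right true (fun b d => b = false ∧ d = .up)
    [(4, false), (5, false)] := by
  constructor
  all_goals decide +kernel

/-- The left part moves right across `(3, 11)`, below the obstacle that stopped the taller right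
part. Afterwards the union stops already at `(2, 11)`, since in column `1` the taller `B` could hit
the obstacle above `A`; it is held there by a topmost tile of `B`. -/
theorem Flow.push (hd : Disjoint A B) (pA : IsPolyomino A) (pB : IsPolyomino B)
    (pP : IsPolyomino (A ∪ B)) (hc : CanPullApart .right B A) (hx : ¬ Extends .up A B)
    (fA : Flow A gA hA SA) (fB : Flow B gB hB SB) : ∃ g h S, Flow (A ∪ B) g h S := by
  obtain ⟨r₀, hr₀, hlt⟩ := not_extends hx
  refine Flow.join pushTable_ok hd (pushTable_ok.valid hd pA pB pP ?_ ?_ ?_) fA fB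
  · exact fun p hp q hq => hc.noTouch hp hq
  · intro b d hbd
    obtain ⟨rfl, rfl⟩ := of_decide_eq_true hbd
    exact fun r hr => ⟨r₀, hr₀, (hlt r hr).le⟩
  · intro x h
    simp only [List.mem_cons, List.not_mem_nil, or_false] at h
    rcases h with rfl | rfl
    · exact stop_of_pull_right hd pB hc (by decide +kernel)
    · have free : ∀ b, Free pushTable 14 b (2, 11) .up := by decide +kernel
      have free' : Free pushTable 14 false (2, 11) .left := by decide +kernel
      obtain ⟨q, hq, hmax⟩ := exists_corner pB.nonempty .up .left
      refine ⟨q, hq, fun b r hr => ?_⟩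
      cases b
      · rcases hmax r hr with h | ⟨-, h⟩
        · exact ⟨.up, free _, by
            rw [sevenCycle_values.2.2.2.2.2.1]; simpa [along, Dir.vec] using h⟩
        · exact ⟨.left, free', lt_along_add_vec h⟩
      · refine ⟨.up, free _, ?_⟩
        have h1 := hmax r₀ hr₀
        have h2 := hlt r hr
        rw [sevenCycle_values.2.2.2.2.2.1]
        simp only [along, Dir.vec, Prod.snd_add] at *
        omega

/-- Macro positions if both polyominoes extend equally far upwards. -/
def levelTable : Bool → ℕ → Cell := tableOf
  [(0, 10), (2, 10), (2, 11), (2, 10), (2, 11), (4, 11), (1, 11), (1, -1),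
    (5, -1), (5, 0), (5, -2), (5, 0), (5, 0), (5, 0), (5, -2), (6, -2)]
  [(0, 0), (3, 0), (3, 11), (3, 0), (3, 11), (4, 11), (1, 11), (1, -1),
    (5, -1), (5, 0), (5, -2), (5, 0), (5, 0), (5, 0), (5, -2), (6, -2)]

theorem levelTable_ok :
    TableOK levelTable 14 .right true (fun _ d => d = .up) [(4, false)] := by
  constructor
  all_goals decide +kernel

/-- With equal heights each part fits below the obstacles that stop the other one, so the union can
return to column `1` across both of these stops. -/
theorem Flow.level (hd : Disjoint A B) (pA : IsPolyomino A) (pB : IsPolyomino B)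
    (pP : IsPolyomino (A ∪ B)) (hc : CanPullApart .right B A) (hx : Extends .up A B)
    (hx' : Extends .up B A) (fA : Flow A gA hA SA) (fB : Flow B gB hB SB) :
    ∃ g h S, Flow (A ∪ B) g h S := by
  refine Flow.join levelTable_ok hd (levelTable_ok.valid hd pA pB pP ?_ ?_ ?_) fA fB
  · exact fun p hp q hq => hc.noTouch hp hq
  · intro b d hbd
    obtain rfl := of_decide_eq_true hbd
    cases b
    exacts [hx', hx]
  · intro x h
    rw [List.mem_singleton] at h
    subst h
    exact stop_of_pull_right hd pB hc (by decide +kernel)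

theorem Flow.horizontal (hd : Disjoint A B) (pA : IsPolyomino A) (pB : IsPolyomino B)
    (pP : IsPolyomino (A ∪ B)) (hc : CanPullApart .right B A)
    (fA : Flow A gA hA SA) (fB : Flow B gB hB SB) : ∃ g h S, Flow (A ∪ B) g h S := by
  by_cases hx : Extends .up A B
  · by_cases hx' : Extends .up B A
    · exact Flow.level hd pA pB pP hc hx hx' fA fB
    · exact Flow.hook hd pA pB pP hc hx' fA fB
  · exact Flow.push hd pA pB pP hc hx fA fB

end Horizontal

/-! ## Line-convex polyominoes are built tile by tile -/

theorem gridGraph_adj_iff (d : Dir) (p q : Cell) :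
    gridGraph.Adj p q ↔ |across d p - across d q| + |along d p - along d q| = 1 := by
  have h : ∀ x y : ℤ, |-x - -y| = |x - y| := fun x y => by
    rw [← abs_neg]; congr 1; ring
  cases d <;> simp only [gridGraph, along, across, h] <;> simp only [add_comm]

/-- `Linked` demands membership of every cell of the path except the first, hence `hp`. -/
theorem Linked.symm {S : Set Cell} {p q : Cell} (hp : p ∈ S) (h : Linked S p q) :
    Linked S q p := by
  have key : ∀ r, Linked S p r → r ∈ S ∧ Linked S r p := by
    intro r hr
    induction hr with
    | refl => exact ⟨hp, .refl⟩
    | tail _ hbc ih => exact ⟨hbc.2, .head ⟨hbc.1.symm, ih.1⟩ ih.2⟩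
  exact (key q h).2

theorem isPolyomino_of_linked {P : Finset Cell} (hne : P.Nonempty)
    (h : ∀ p ∈ P, ∀ q ∈ P, Linked (P : Set Cell) p q) : IsPolyomino P := by
  obtain ⟨x, hx⟩ := hne
  have : Nonempty ↥(P : Set Cell) := ⟨⟨x, hx⟩⟩
  refine SimpleGraph.Connected.mk fun ⟨p, hp⟩ ⟨q, hq⟩ => ?_
  have key : ∀ r, Linked (P : Set Cell) p r → ∃ hr : r ∈ (P : Set Cell),
      (gridGraph.induce (P : Set Cell)).Reachable ⟨p, hp⟩ ⟨r, hr⟩ := by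
    intro r hr
    induction hr with
    | refl => exact ⟨hp, .refl _⟩
    | tail _ hbc ih =>
      obtain ⟨hb, ih⟩ := ih
      refine ⟨hbc.2, ih.trans (SimpleGraph.Adj.reachable ?_)⟩
      exact hbc.1
  exact (key q (h p hp q hq)).2

/-- Each line parallel to `f` meets `S` in a connected set. -/
def LineConvex (f : Dir) (S : Finset Cell) : Prop :=
  ∀ p ∈ S, ∀ q ∈ S, ∀ r, across f p = across f r → across f q = across f r →
    along f p ≤ along f r → along f r ≤ along f q → r ∈ S

theorem adj_add_vec (f : Dir) (p : Cell) : gridGraph.Adj p (p + f.vec) := by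
  cases f <;> simp [gridGraph, Dir.vec]

theorem across_add_vec (f : Dir) (p : Cell) : across f (p + f.vec) = across f p := by
  simpa using across_add_smul f p 1

theorem LineConvex.linked_of_le {f : Dir} {S : Finset Cell} (h : LineConvex f S) (n : ℕ) :
    ∀ p ∈ S, ∀ q ∈ S, across f p = across f q → along f q = along f p + n →
      Linked (S : Set Cell) p q := by
  induction n with
  | zero =>
    intro p _ q _ h1 h2
    rw [eq_of_along_across (d := f) (by simpa using h2.symm) h1]
    exact .refl
  | succ n ih =>
    intro p hp q hq h1 h2
    push_cast at h2
    have hr : p + f.vec ∈ S := by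
      refine h p hp q hq _ ?_ ?_ ?_ ?_
      · rw [across_add_vec]
      · rw [across_add_vec, h1]
      · rw [along_add_vec]; omega
      · rw [along_add_vec]; omega
    refine .head ⟨adj_add_vec f p, hr⟩ (ih _ hr q hq ?_ ?_)
    · rw [across_add_vec, h1]
    · rw [along_add_vec]; omega

theorem LineConvex.linked {f : Dir} {S : Finset Cell} (h : LineConvex f S) {p q : Cell}
    (hp : p ∈ S) (hq : q ∈ S) (hpq : across f p = across f q) : Linked (S : Set Cell) p q := by
  rcases le_total (along f p) (along f q) with hle | hle
  · exact h.linked_of_le (along f q - along f p).toNat p hp q hq hpq (by omega)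
  · exact (h.linked_of_le (along f p - along f q).toNat q hq p hp hpq.symm (by omega)).symm hq

/-- After a displacement of at least `1` the tiles are at least two apart along `e`, which excludes
overlap and adjacency. -/
theorem canPullApart_of_lt {e : Dir} {A B : Finset Cell}
    (h : ∀ a ∈ A, ∀ b ∈ B, along e b < along e a) : CanPullApart e A B := by
  intro k hk a ha b hb
  have h1 := h a ha b hb
  have h2 := along_add_smul e a k
  refine ⟨fun hab => ?_, fun hab => ?_⟩
  · rw [hab] at h2; omega
  · have h3 := (gridGraph_adj_iff e _ _).1 hab.2
    have h4 := abs_nonneg (across e (a + k • e.vec) - across e b)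
    have h5 := le_abs_self (along e (a + k • e.vec) - along e b)
    omega

/-- Removing a part whose neighbours outside all lie on one line leaves a polyomino. -/
theorem IsPolyomino.of_line_boundary {P A B : Finset Cell} {f : Dir} (hP : IsPolyomino P)
    (hAB : P = A ∪ B) (hB : B.Nonempty) (hconv : LineConvex f B)
    (hline : ∀ b ∈ B, ∀ a ∈ A, ∀ b' ∈ B, ∀ a' ∈ A, gridGraph.Adj a b → gridGraph.Adj a' b' →
      across f b = across f b') : IsPolyomino B := by
  classical
  obtain ⟨p₀, hp₀, hlink⟩ : ∃ p₀ ∈ B, ∀ b ∈ B, ∀ a ∈ A, gridGraph.Adj a b →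
      Linked (B : Set Cell) b p₀ := by
    by_cases h : ∃ b ∈ B, ∃ a ∈ A, gridGraph.Adj a b
    · obtain ⟨b₀, hb₀, a₀, ha₀, h₀⟩ := h
      exact ⟨b₀, hb₀, fun b hb a ha hab =>
        hconv.linked hb hb₀ (hline b hb a ha b₀ hb₀ a₀ ha₀ hab h₀)⟩
    · obtain ⟨b₀, hb₀⟩ := hB
      exact ⟨b₀, hb₀, fun b hb a ha hab => (h ⟨b, hb, a, ha, hab⟩).elim⟩
  refine isPolyomino_of_linked hB fun p hp q hq => ?_
  have hpP : p ∈ P := by rw [hAB]; exact Finset.mem_union_right _ hp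
  have hqP : q ∈ P := by rw [hAB]; exact Finset.mem_union_right _ hq
  -- A path in `P` is followed, with every cell outside `B` replaced by `p₀`. It leaves and enters
  -- `B` only on the common line, where `B` is linked to `p₀`.
  have key : ∀ r, Linked (P : Set Cell) p r → r ∈ P ∧
      Linked (B : Set Cell) p (if r ∈ B then r else p₀) := by
    intro r hr
    induction hr with
    | refl => exact ⟨hpP, by rw [if_pos hp]; exact .refl⟩
    | @tail x y _ hxy ih =>
      refine ⟨hxy.2, ih.2.trans ?_⟩
      have hxP := ih.1
      have hyP : y ∈ P := hxy.2
      rw [hAB, Finset.mem_union] at hxP hyP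
      by_cases hx : x ∈ B <;> by_cases hy : y ∈ B
      · rw [if_pos hx, if_pos hy]; exact .single ⟨hxy.1, hy⟩
      · rw [if_pos hx, if_neg hy]
        exact hlink x hx y (hyP.resolve_right hy) hxy.1.symm
      · rw [if_neg hx, if_pos hy]
        exact (hlink y hy x (hxP.resolve_right hx) hxy.1).symm hy
      · rw [if_neg hx, if_neg hy]
  have := (key q (hP.linked hpP hqP)).2
  rwa [if_pos hq] at this

/-! ### Flows along a decomposition tree -/

/-- Some flow builds `P`. -/
def HasFlow (P : Finset Cell) : Prop := ∃ g h S, Flow P g h S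

theorem canPullApart_swap {d d' : Dir} (hd : d'.vec = -d.vec) {A B : Finset Cell}
    (h : CanPullApart d A B) : CanPullApart d' B A := by
  intro k hk b hb a ha
  have := h.noTouch' hd ha hb k hk
  exact ⟨this.1.symm, fun hc => this.2 ⟨hc.1.symm, hc.2.symm⟩⟩

/-- Exchanging the parts reverses the direction of the cut, which leaves one vertical and one
horizontal case. -/
theorem HasFlow.of_cut {P A B : Finset Cell} (h : IsValidTwoCut P A B) (hA : HasFlow A)
    (hB : HasFlow B) : HasFlow P := by
  obtain ⟨pP, pA, pB, hd, rfl, d, hc⟩ := h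
  obtain ⟨gA, hA, SA, fA⟩ := hA
  obtain ⟨gB, hB, SB, fB⟩ := hB
  have pP' : IsPolyomino (B ∪ A) := by rwa [Finset.union_comm]
  cases d
  · rw [Finset.union_comm]
    exact Flow.horizontal hd.symm pB pA pP' hc fB fA
  · exact Flow.vertical hd pA pB pP hc fA fB
  · exact Flow.horizontal hd pA pB pP (canPullApart_swap (by simp [Dir.vec]) hc) fA fB
  · rw [Finset.union_comm]
    exact Flow.vertical hd.symm pB pA pP' (canPullApart_swap (by simp [Dir.vec]) hc) fB fA

theorem isPolyomino_singleton (p : Cell) : IsPolyomino {p} := by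
  refine isPolyomino_of_linked ⟨p, by simp⟩ fun a ha b hb => ?_
  rw [Finset.mem_singleton] at ha hb
  rw [ha, hb]
  exact .refl

theorem LineConvex.filter_line {f : Dir} {S : Finset Cell} (h : LineConvex f S) (x : ℤ → Prop)
    [DecidablePred x] : LineConvex f (S.filter fun p => x (across f p)) := by
  intro p hp q hq r h1 h2 h3 h4
  rw [Finset.mem_filter] at hp hq ⊢
  exact ⟨h p hp.1 q hq.1 r h1 h2 h3 h4, h1 ▸ hp.2⟩

/-- Induction on the number of tiles. The line furthest in direction `e` is cut off by a straight
cut; the rest stays connected because it touches that line only along the next one. Once a single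
line is left, its end tile is cut off. -/
theorem hasFlow_of_lineConvex {f e : Dir} (hfe : ∀ v, across f v = along e v) (n : ℕ) :
    ∀ P : Finset Cell, P.card = n → IsPolyomino P → LineConvex f P → HasFlow P := by
  induction n using Nat.strong_induction_on with
  | _ n ih =>
  intro P hn hP hconv
  obtain ⟨m, hm, hmax⟩ := exists_max_along hP.nonempty e
  have split : ∀ A B : Finset Cell, Disjoint A B → A ∪ B = P → A.Nonempty → B.Nonempty →
      A.card < n ∧ B.card < n := by
    intro A B hd hAB hA hB
    have := Finset.card_union_of_disjoint hd
    rw [hAB, hn] at this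
    have := hA.card_pos
    have := hB.card_pos
    omega
  by_cases hB : (P.filter fun p => across f p < along e m).Nonempty
  · set A := P.filter fun p => across f p = along e m with hAdef
    set B := P.filter fun p => across f p < along e m with hBdef
    have hAne : A.Nonempty := ⟨m, by rw [hAdef, Finset.mem_filter]; exact ⟨hm, hfe m⟩⟩
    have hd : Disjoint A B := by
      rw [Finset.disjoint_left]
      intro a ha hb
      rw [hAdef, Finset.mem_filter] at ha
      rw [hBdef, Finset.mem_filter] at hb
      omega
    have hAB : A ∪ B = P := by
      ext p
      rw [Finset.mem_union, hAdef, hBdef, Finset.mem_filter, Finset.mem_filter]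
      have := hmax p
      rw [← hfe p] at this
      constructor
      · rintro (h | h) <;> exact h.1
      · intro h
        have := this h
        rcases lt_or_eq_of_le this with h' | h'
        exacts [.inr ⟨h, h'⟩, .inl ⟨h, h'⟩]
    have cA : LineConvex f A := hconv.filter_line (fun x => x = along e m)
    have cB : LineConvex f B := hconv.filter_line (fun x => x < along e m)
    have mA : ∀ a ∈ A, across f a = along e m := fun a ha => (Finset.mem_filter.1 ha).2
    have mB : ∀ b ∈ B, across f b < along e m := fun b hb => (Finset.mem_filter.1 hb).2
    have pA : IsPolyomino A := isPolyomino_of_linked hAne fun p hp q hq =>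
      cA.linked hp hq (by rw [mA p hp, mA q hq])
    have pB : IsPolyomino B := by
      refine hP.of_line_boundary hAB.symm hB cB ?_
      have key : ∀ b ∈ B, ∀ a ∈ A, gridGraph.Adj a b → across f b = along e m - 1 := by
        intro b hb a ha hab
        have h1 := (gridGraph_adj_iff f _ _).1 hab
        have h2 := mA a ha
        have h3 := mB b hb
        have h4 := le_abs_self (across f a - across f b)
        have h5 := abs_nonneg (along f a - along f b)
        omega
      intro b hb a ha b' hb' a' ha' hab hab'
      rw [key b hb a ha hab, key b' hb' a' ha' hab']
    obtain ⟨lA, lB⟩ := split A B hd hAB hAne hB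
    refine HasFlow.of_cut ⟨hP, pA, pB, hd, hAB, e, canPullApart_of_lt ?_⟩
      (ih _ lA A rfl pA cA) (ih _ lB B rfl pB cB)
    intro a ha b hb
    rw [← hfe, ← hfe, mA a ha]
    exact mB b hb
  · have line : ∀ p ∈ P, across f p = along e m := by
      intro p hp
      have h1 := hmax p hp
      rw [← hfe p] at h1
      by_contra h
      exact hB ⟨p, Finset.mem_filter.2 ⟨hp, lt_of_le_of_ne h1 h⟩⟩
    obtain ⟨t, ht, htop⟩ := exists_max_along hP.nonempty f
    by_cases hB' : (P.erase t).Nonempty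
    · have hd : Disjoint {t} (P.erase t) := by simp
      have hAB : {t} ∪ P.erase t = P := by
        rw [← Finset.insert_eq, Finset.insert_erase ht]
      have lt : ∀ b ∈ P.erase t, along f b < along f t := by
        intro b hb
        obtain ⟨h1, h2⟩ := Finset.mem_erase.1 hb
        refine lt_of_le_of_ne (htop b h2) fun h => h1 (eq_of_along_across h ?_)
        rw [line b h2, line t ht]
      have cB : LineConvex f (P.erase t) := by
        intro p hp q hq r h1 h2 h3 h4
        have := lt q hq
        rw [Finset.mem_erase] at hp hq ⊢
        exact ⟨fun h => by rw [h] at h4; omega, hconv p hp.2 q hq.2 r h1 h2 h3 h4⟩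
      have pB : IsPolyomino (P.erase t) := isPolyomino_of_linked hB' fun p hp q hq =>
        cB.linked hp hq (by
          rw [line p (Finset.mem_of_mem_erase hp), line q (Finset.mem_of_mem_erase hq)])
      obtain ⟨-, lB⟩ := split {t} (P.erase t) hd hAB (by simp) hB'
      refine HasFlow.of_cut ⟨hP, isPolyomino_singleton t, pB, hd, hAB, f, canPullApart_of_lt ?_⟩
        ⟨_, _, _, Flow.single t (isPolyomino_singleton t)⟩ (ih _ lB _ rfl pB cB)
      intro a ha b hb
      rw [Finset.mem_singleton.1 ha]
      exact lt b hb
    · have : P = {t} := by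
        rw [Finset.not_nonempty_iff_eq_empty, Finset.erase_eq_empty_iff] at hB'
        exact hB'.resolve_left hP.nonempty.ne_empty
      rw [this]
      exact ⟨_, _, _, Flow.single t (isPolyomino_singleton t)⟩

theorem IsMonotonePolyomino.hasFlow {P : Finset Cell} (h : IsMonotonePolyomino P) :
    HasFlow P := by
  obtain ⟨hP, hc | hr⟩ := h
  · refine hasFlow_of_lineConvex (f := .up) (e := .right) (fun _ => rfl) _ P rfl hP ?_
    rintro ⟨x₁, y₁⟩ hp ⟨x₂, y₂⟩ hq ⟨x, y⟩ h1 h2 h3 h4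
    simp only [across, along] at h1 h2 h3 h4
    subst h1 h2
    exact hc _ _ _ _ hp hq h3 h4
  · refine hasFlow_of_lineConvex (f := .right) (e := .up) (fun _ => rfl) _ P rfl hP ?_
    rintro ⟨x₁, y₁⟩ hp ⟨x₂, y₂⟩ hq ⟨x, y⟩ h1 h2 h3 h4
    simp only [across, along] at h1 h2 h3 h4
    subst h1 h2
    exact hr _ _ _ _ hp hq h3 h4

theorem DecompositionTree.hasFlow {P : Finset Cell} (T : DecompositionTree P) :
    IsPolyomino P ∧ HasFlow P := by
  induction T with
  | leaf P h => exact ⟨h.1, h.hasFlow⟩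
  | node P A B h _ _ ihA ihB => exact ⟨h.1, .of_cut h ihA.2 ihB.2⟩

/-! ## Flows that continue forever -/

/-- A flow in all steps that builds `P` until time `0`, and a scale `N` that separates the tiles at
different macro vertices. -/
structure Eternal (P : Finset Cell) (g : Cell → ℤ → Cell) (S N : ℤ) : Prop where
  valid : Valid Set.univ Set.univ P g
  joined : ∀ p ∈ P, ∀ s, 0 ≤ s → g p s = conv s
  loose : ∀ s ≤ -S, ∀ p ∈ P, ∀ q ∈ P, p ≠ q → g p s ≠ g q s
  scale : ∀ p ∈ P, ∀ q ∈ P, |p.1 - q.1| + 3 ≤ N ∧ |p.2 - q.2| + 3 ≤ N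
  poly : IsPolyomino P

theorem exists_scale (P : Finset Cell) :
    ∃ N : ℤ, ∀ p ∈ P, ∀ q ∈ P, |p.1 - q.1| + 3 ≤ N ∧ |p.2 - q.2| + 3 ≤ N := by
  obtain ⟨M, hM⟩ := ((P ×ˢ P).image fun x : Cell × Cell =>
    max (|x.1.1 - x.2.1|) (|x.1.2 - x.2.2|)).bddAbove
  refine ⟨M + 3, fun p hp q hq => ?_⟩
  have := hM (Finset.mem_coe.2 (Finset.mem_image.2 ⟨(p, q), by simp [hp, hq], rfl⟩))
  have h := max_le_iff.1 this
  dsimp only at h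
  constructor <;> linarith [h.1, h.2]

/-- The first step of the conveyor is the exit step of a flow, so the two can be glued at time `0`.
-/
theorem Flow.eternal {P : Finset Cell} {g : Cell → ℤ → Cell} {h S : ℤ} (f : Flow P g h S)
    (hP : IsPolyomino P) : ∃ G S' N, Eternal P G S' N := by
  obtain ⟨N, hN⟩ := exists_scale P
  set G : Cell → ℤ → Cell := fun p s => if s ≤ 0 then g p s else conv s with hG
  have neg : ∀ p s, s ≤ 0 → G p s = g p s := fun p s hs => if_pos hs
  have pos : ∀ p ∈ P, ∀ s, 0 ≤ s → G p s = conv s := by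
    intro p hp s hs
    rcases eq_or_lt_of_le hs with rfl | hs
    · rw [neg p 0 le_rfl, f.zero p hp]; rfl
    · exact if_neg (by omega)
  have hold : Valid {s | s < 0} {s | s ≤ 0} P
      fun p s => if s ≤ 0 then G p s else (1, (G p 0).2) := by
    have old : ∀ p ∈ P, ∀ s ≤ 1, (if s ≤ 0 then G p s else (1, (G p 0).2)) = g p s := by
      intro p hp s hs
      by_cases h : s ≤ 0
      · rw [if_pos h, neg p s h]
      · obtain rfl : s = 1 := by omega
        rw [if_neg h, neg p 0 le_rfl, f.zero p hp, f.one p hp]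
    refine f.valid.congr ?_ ?_
    · exact fun p hp s (hs : s < 0) => ⟨old p hp s (by omega), old p hp (s + 1) (by omega)⟩
    · exact fun p hp s (hs : s ≤ 0) => ⟨old p hp s (by omega), old p hp (s + 1) (by omega)⟩
  have convx : ∀ s : ℤ, 1 ≤ s → 1 ≤ (conv s).1 := by
    intro s hs
    unfold conv; split_ifs <;> simp <;> omega
  have hV := Valid.glue (I := Set.univ) (J := Set.univ) hold ?_ (Set.mem_univ _) ?_ ?_ ?_ ?_
  · refine ⟨G, max S 0, N, hV.mono (fun _ _ _ => trivial) (fun _ _ _ => trivial), pos, ?_, hN, hP⟩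
    intro s hs p hp q hq hpq
    rw [neg p s (by omega), neg q s (by omega)]
    exact f.loose s (by omega) p hp q hq hpq
  · refine ((conv_valid hP).mono (Set.subset_univ _) (Set.subset_univ _)).congr ?_ ?_ <;>
    · rintro p hp s ⟨hs, -⟩
      exact ⟨pos p hp s hs, pos p hp (s + 1) (by omega)⟩
  · intro p hp s hs
    rw [neg p s hs]; exact f.left p hp s hs
  · intro p hp s hs hm
    rw [neg p s hs.le]; exact f.left' p hp s hs hm
  · intro p hp
    rw [neg p 0 le_rfl, f.zero p hp]
  · intro p hp s _
    refine ⟨fun hs => ?_, fun hs => ?_⟩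
    · rw [pos p hp s (by omega)]; exact convx s hs
    · rw [pos p hp (s + 1) (by omega)]; exact convx _ (by omega)

/-! ## Unit motions -/

theorem along_add (d : Dir) (p q : Cell) : along d (p + q) = along d p + along d q := by
  cases d <;> simp [along] <;> ring

theorem across_add (d : Dir) (p q : Cell) : across d (p + q) = across d p + across d q := by
  cases d <;> simp [across]

theorem along_smul (d : Dir) (N : ℤ) (p : Cell) : along d (N • p) = N * along d p := by
  cases d <;> simp [along]

theorem across_smul (d : Dir) (N : ℤ) (p : Cell) : across d (N • p) = N * across d p := by
  cases d <;> simp [across]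

/-- The number of unit motions of the tile `p` in step `s`. -/
def len (g : Cell → ℤ → Cell) (N : ℤ) (p : Cell) (s : ℤ) : ℕ :=
  (N * (along (cyc s) (g p (s + 1)) - along (cyc s) (g p s))).toNat

/-- The cell of the tile `p` after `t` unit motions of step `s`. -/
def fine (g : Cell → ℤ → Cell) (N : ℤ) (p : Cell) (s : ℤ) (t : ℕ) : Cell :=
  p + N • g p s + min t (len g N p s) • (cyc s).vec

theorem gridGraph_adj_add (p q v : Cell) : gridGraph.Adj (p + v) (q + v) ↔ gridGraph.Adj p q := by
  simp [gridGraph]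

theorem tileColor_ne_of_adj {p q : Cell} (h : gridGraph.Adj p q) : tileColor p ≠ tileColor q := by
  intro e
  have h' : |p.1 - q.1| + |p.2 - q.2| = 1 := h
  unfold tileColor at e
  rw [decide_eq_decide, Int.even_iff, Int.even_iff] at e
  rcases abs_cases (p.1 - q.1) with h1 | h1 <;> rcases abs_cases (p.2 - q.2) with h2 | h2 <;> omega

/-- Offsets that differ by less than `N` act as digits below the multiples of `N`. -/
theorem lexLE_of_le {a r w c N : ℤ} (hN : |c - r| < N) (h : r + N * a ≤ c + N * w) :
    LexLE a r w c := by
  rcases lt_trichotomy a w with h1 | h1 | h1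
  · exact .inl h1
  · subst h1
    exact .inr ⟨rfl, by omega⟩
  · have h2 := abs_lt.1 hN
    have h3 : N * (w + 1) ≤ N * a := mul_le_mul_of_nonneg_left h1 (by linarith [abs_nonneg (c - r)])
    linarith

theorem Eternal.scale_pos {P : Finset Cell} {g : Cell → ℤ → Cell} {S N : ℤ}
    (h : Eternal P g S N) : 3 ≤ N := by
  obtain ⟨p, hp⟩ := h.poly.nonempty
  have := (h.scale p hp p hp).1
  simpa using this

theorem Eternal.scale_along {P : Finset Cell} {g : Cell → ℤ → Cell} {S N : ℤ}
    (h : Eternal P g S N) {p q : Cell} (hp : p ∈ P) (hq : q ∈ P) (d : Dir) :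
    along d p - along d q ≤ N - 3 ∧ across d p - across d q ≤ N - 3 := by
  have h1 := h.scale p hp q hq
  have h2 := abs_le.1 (show |p.1 - q.1| ≤ N - 3 by linarith)
  have h3 := abs_le.1 (show |p.2 - q.2| ≤ N - 3 by linarith)
  cases d <;> simp only [along, across] <;> omega

theorem Eternal.len_eq {P : Finset Cell} {g : Cell → ℤ → Cell} {S N : ℤ}
    (h : Eternal P g S N) {p : Cell} (hp : p ∈ P) (s : ℤ) : (len g N p s : ℤ) =
    N * along (cyc s) (g p (s + 1)) - N * along (cyc s) (g p s) := by
  have h1 := (h.valid.step s trivial p hp).2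
  have h2 := h.scale_pos
  rw [len, Int.toNat_of_nonneg (mul_nonneg (by omega) (by omega)), mul_sub]

theorem along_fine {g : Cell → ℤ → Cell} {N : ℤ} (p : Cell) (s : ℤ) (t : ℕ) :
    along (cyc s) (fine g N p s t) =
    along (cyc s) p + N * along (cyc s) (g p s) + min (t : ℤ) (len g N p s) := by
  rw [fine, along_add_smul, along_add, along_smul]
  push_cast
  rfl

theorem across_fine {g : Cell → ℤ → Cell} {N : ℤ} (p : Cell) (s : ℤ) (t : ℕ) :
    across (cyc s) (fine g N p s t) =
    across (cyc s) p + N * across (cyc s) (g p s) := by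
  rw [fine, across_add_smul, across_add, across_smul]

theorem fine_zero {g : Cell → ℤ → Cell} {N : ℤ} (p : Cell) (s : ℤ) :
    fine g N p s 0 = p + N • g p s := by
  simp [fine]

theorem Eternal.fine_end {P : Finset Cell} {g : Cell → ℤ → Cell} {S N : ℤ}
    (h : Eternal P g S N) {p : Cell} (hp : p ∈ P) {s : ℤ} {t : ℕ} (ht : len g N p s ≤ t) :
    fine g N p s t = p + N • g p (s + 1) := by
  have h1 := h.len_eq hp s
  have h2 := (h.valid.step s trivial p hp).1
  refine eq_of_along_across (d := cyc s) ?_ ?_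
  · rw [along_fine, along_add, along_smul]
    omega
  · rw [across_fine, across_add, across_smul, h2]

theorem Eternal.mul_le {P : Finset Cell} {g : Cell → ℤ → Cell} {S N : ℤ}
    (h : Eternal P g S N) {x y : ℤ} (hxy : x < y) : N * x + N ≤ N * y := by
  have : N * (x + 1) ≤ N * y := mul_le_mul_of_nonneg_left hxy (by have := h.scale_pos; omega)
  linarith

/-- Tiles in neighbouring cells, or in the same cell, are on the same macro line. -/
theorem Eternal.across_eq {P : Finset Cell} {g : Cell → ℤ → Cell} {S N : ℤ}
    (h : Eternal P g S N) {p q : Cell} (hp : p ∈ P) (hq : q ∈ P) {d : Dir} {a b : ℤ}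
    (h1 : across d p + N * a - (across d q + N * b) ≤ 2)
    (h2 : across d q + N * b - (across d p + N * a) ≤ 2) : a = b := by
  have h3 := (h.scale_along hp hq d).2
  have h4 := (h.scale_along hq hp d).2
  rcases lt_trichotomy a b with hab | hab | hab
  · have := h.mul_le hab
    omega
  · exact hab
  · have := h.mul_le hab
    omega

theorem adj_bounds {d : Dir} {u v : Cell} (huv : gridGraph.Adj u v) :
    (along d u - along d v ≤ 1 ∧ along d v - along d u ≤ 1) ∧
      across d u - across d v ≤ 1 ∧ across d v - across d u ≤ 1 := by
  have h1 := (gridGraph_adj_iff d u v).1 huv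
  have h2 := abs_nonneg (across d u - across d v)
  have h3 := abs_nonneg (along d u - along d v)
  have h4 := abs_le.1 (show |across d u - across d v| ≤ 1 by omega)
  have h5 := abs_le.1 (show |along d u - along d v| ≤ 1 by omega)
  omega

/-- Particles at rest that touch are at the same macro vertex. -/
theorem Eternal.rest_eq {P : Finset Cell} {g : Cell → ℤ → Cell} {S N : ℤ}
    (h : Eternal P g S N) {p q v w : Cell} (hp : p ∈ P) (hq : q ∈ P)
    (hvw : p + N • v = q + N • w ∨ gridGraph.Adj (p + N • v) (q + N • w)) : v = w := by
  have key : ∀ d, across d v = across d w := by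
    intro d
    have : across d (p + N • v) - across d (q + N • w) ≤ 1 ∧
        across d (q + N • w) - across d (p + N • v) ≤ 1 := by
      rcases hvw with e | e
      · rw [e]; simp
      · exact (adj_bounds e).2
    rw [across_add, across_add, across_smul, across_smul] at this
    exact h.across_eq hp hq (d := d) (by omega) (by omega)
  exact Prod.ext (key .up) (key .right)

/-- A moving tile neither runs into a tile that has come to rest nor sticks to it. -/
theorem Eternal.moving_clear {P : Finset Cell} {g : Cell → ℤ → Cell} {S N : ℤ}
    (h : Eternal P g S N) {p q : Cell} (hp : p ∈ P) (hq : q ∈ P) {s s' : ℤ}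
    (hs : s % 7 = s' % 7) {t : ℕ} (ht : t < len g N p s) (ht' : len g N q s' ≤ t) :
    fine g N p s t + (cyc s).vec ≠ fine g N q s' t ∧
    ¬ (tileColor p ≠ tileColor q ∧ gridGraph.Adj (fine g N p s t) (fine g N q s' t)) := by
  have hc : cyc s' = cyc s := cyc_congr hs.symm
  have lp := h.len_eq hp s
  have lq := h.len_eq hq s'
  have xp := along_fine (g := g) (N := N) p s t
  have xq := along_fine (g := g) (N := N) q s' t
  have yp := across_fine (g := g) (N := N) p s t
  have yq := across_fine (g := g) (N := N) q s' t
  rw [hc] at lq xq yq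
  by_contra hcon
  have touch : fine g N p s t + (cyc s).vec = fine g N q s' t ∨ (tileColor p ≠ tileColor q ∧
      gridGraph.Adj (fine g N p s t) (fine g N q s' t)) := by
    by_contra hh
    rw [not_or] at hh
    exact hcon hh
  have near : (along (cyc s) (fine g N p s t) - along (cyc s) (fine g N q s' t) ≤ 1 ∧
      along (cyc s) (fine g N q s' t) - along (cyc s) (fine g N p s t) ≤ 1) ∧
      across (cyc s) (fine g N p s t) - across (cyc s) (fine g N q s' t) ≤ 1 ∧
      across (cyc s) (fine g N q s' t) - across (cyc s) (fine g N p s t) ≤ 1 := by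
    rcases touch with e | e
    · rw [← e, along_add_vec, across_add_vec]; omega
    · exact adj_bounds e.2
  have hacross : across (cyc s) (g p s) = across (cyc s) (g q s') :=
    h.across_eq hp hq (d := cyc s) (by omega) (by omega)
  have n1 := (h.scale_along hp hq (cyc s)).1
  have n2 := (h.scale_along hq hp (cyc s)).1
  rcases lt_trichotomy (along (cyc s) (g p s)) (along (cyc s) (g q s')) with hlt | heq | hlt
  -- Offsets differ by at most `N - 3`, so if `p` ended at a vertex behind that of `q`, it would
  -- stay three cells away.
  · have far : ¬ Ahead (cyc s) (g p (s + 1)) (g q (s' + 1)) := by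
      intro ha
      have := h.mul_le ha.2
      omega
    by_cases hss : s = s'
    · subst hss
      rcases h.valid.meet s trivial p hp q hq ⟨hacross, hlt⟩ with ha | ⟨hend, hnt⟩
      · exact far ha
      -- With `k` unit motions left, `q` lies relative to `p` as if it were displaced by `k` from
      -- its final place, which is the situation in `NoTouch`.
      · obtain ⟨k, hk⟩ : ∃ k : ℕ, t + k = len g N p s := ⟨len g N p s - t, by omega⟩
        have hq' : fine g N q s t = q + N • g p (s + 1) := by rw [h.fine_end hq ht', hend]
        have hp' : fine g N p s t + k • (cyc s).vec = p + N • g p (s + 1) := by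
          rw [← h.fine_end hp le_rfl, fine, fine, add_assoc, ← add_smul]
          congr 2
          omega
        have hkpos : 0 < k := by omega
        rcases touch with e | e
        · obtain ⟨k', rfl⟩ : ∃ k', k = k' + 1 := ⟨k - 1, by omega⟩
          have e2 : p = q + k' • (cyc s).vec := by
            have : p + N • g p (s + 1) = q + k' • (cyc s).vec + N • g p (s + 1) := by
              rw [← hp', succ_nsmul', ← add_assoc, e, hq']; abel
            exact add_right_cancel this
          rcases Nat.eq_zero_or_pos k' with rfl | hk'
          · rw [zero_smul, add_zero] at e2
            rw [e2] at hlt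
            exact lt_irrefl _ hlt
          · exact (hnt k' hk').1 e2
        · refine (hnt k hkpos).2 ⟨e.1, ?_⟩
          have e2 := (gridGraph_adj_add _ _ (k • (cyc s).vec)).2 e.2
          rw [hp', hq', add_right_comm, gridGraph_adj_add] at e2
          exact e2
    · exact far ((h.valid.apart s trivial s' trivial hs hss p hp q hq).2 ⟨hacross, hlt⟩)
  · have hg : g p s = g q s' := eq_of_along_across heq hacross
    by_cases hss : s = s'
    · subst hss
      have := h.valid.together s trivial p hp q hq hg
      rw [this, heq] at lp
      omega
    · exact (h.valid.apart s trivial s' trivial hs hss p hp q hq).1 hg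
  -- Here `q` started behind `p` and has already stopped, so the gap has not shrunk.
  · have := h.mul_le hlt
    omega

/-- Tiles that stick to each other belong to the same copy and are or get joined. -/
theorem Eternal.bond_cases {P : Finset Cell} {g : Cell → ℤ → Cell} {S N : ℤ}
    (h : Eternal P g S N) {p q : Cell} (hp : p ∈ P) (hq : q ∈ P) {s s' : ℤ}
    (hs : s % 7 = s' % 7) {t : ℕ} (hadj : gridGraph.Adj (fine g N p s t) (fine g N q s' t)) :
    s = s' ∧ (g p s = g q s ∨ g p s ≠ g q s ∧ g p (s + 1) = g q (s + 1)) := by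
  have main : ∀ p ∈ P, ∀ q ∈ P, ∀ s s' : ℤ, s % 7 = s' % 7 →
      gridGraph.Adj (fine g N p s t) (fine g N q s' t) →
      across (cyc s) (g p s) = across (cyc s) (g q s') →
      along (cyc s) (g p s) < along (cyc s) (g q s') → s = s' ∧ g p (s + 1) = g q (s + 1) := by
    intro p hp q hq s s' hs hadj hacross hlt
    have hc : cyc s' = cyc s := cyc_congr hs.symm
    have lp := h.len_eq hp s
    have lq := h.len_eq hq s'
    have xp := along_fine (g := g) (N := N) p s t
    have xq := along_fine (g := g) (N := N) q s' t
    rw [hc] at lq xq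
    have near := (adj_bounds (d := cyc s) hadj).1
    have n1 := (h.scale_along hp hq (cyc s)).1
    have n2 := (h.scale_along hq hp (cyc s)).1
    have far : ¬ Ahead (cyc s) (g p (s + 1)) (g q (s' + 1)) := by
      intro ha
      have := h.mul_le ha.2
      have := h.mul_le hlt
      omega
    by_cases hss : s = s'
    · subst hss
      rcases h.valid.meet s trivial p hp q hq ⟨hacross, hlt⟩ with ha | ha
      exacts [(far ha).elim, ⟨rfl, ha.1⟩]
    · exact (far ((h.valid.apart s trivial s' trivial hs hss p hp q hq).2 ⟨hacross, hlt⟩)).elim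
  have hc : cyc s' = cyc s := cyc_congr hs.symm
  have near := (adj_bounds (d := cyc s) hadj).2
  have yp := across_fine (g := g) (N := N) p s t
  have yq := across_fine (g := g) (N := N) q s' t
  rw [hc] at yq
  have hacross : across (cyc s) (g p s) = across (cyc s) (g q s') :=
    h.across_eq hp hq (d := cyc s) (by omega) (by omega)
  rcases lt_trichotomy (along (cyc s) (g p s)) (along (cyc s) (g q s')) with hlt | heq | hlt
  · obtain ⟨rfl, he⟩ := main p hp q hq s s' hs hadj hacross hlt
    exact ⟨rfl, .inr ⟨fun e => by rw [e] at hlt; exact lt_irrefl _ hlt, he⟩⟩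
  · have hg : g p s = g q s' := eq_of_along_across heq hacross
    by_cases hss : s = s'
    · subst hss
      exact ⟨rfl, .inl hg⟩
    · exact ((h.valid.apart s trivial s' trivial hs hss p hp q hq).1 hg).elim
  · obtain ⟨rfl, he⟩ := main q hq p hp s' s hs.symm hadj.symm (by rw [hc]; exact hacross.symm)
      (by rw [hc]; exact hlt)
    exact ⟨rfl, .inr ⟨fun e => by rw [e] at hlt; exact lt_irrefl _ hlt, he.symm⟩⟩

/-! ### Obstacles as unswept cells -/

/-- The cells that the tiles sweep over. -/
def swept (P : Finset Cell) (g : Cell → ℤ → Cell) (N : ℤ) : Set Cell :=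
  {z | ∃ p ∈ P, ∃ s t, z = fine g N p s t}

theorem Eternal.hit_of_swept {P : Finset Cell} {g : Cell → ℤ → Cell} {S N : ℤ}
    (h : Eternal P g S N) {q w : Cell} {d : Dir} (hq : q ∈ P)
    (hz : q + N • w + d.vec ∈ swept P g N) :
    ∃ r ∈ P, ∃ s, Hit (g r s) (g r (s + 1)) w r (q + d.vec) := by
  obtain ⟨r, hr, s, t, e⟩ := hz
  refine ⟨r, hr, s, ?_⟩
  have hsc := h.scale q hq r hr
  have b1 : |(q + d.vec).1 - r.1| < N := by
    have := abs_le.1 (show |q.1 - r.1| ≤ N - 3 by linarith)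
    rw [abs_lt]
    cases d <;> simp [Dir.vec] <;> omega
  have b2 : |(q + d.vec).2 - r.2| < N := by
    have := abs_le.1 (show |q.2 - r.2| ≤ N - 3 by linarith)
    rw [abs_lt]
    cases d <;> simp [Dir.vec] <;> omega
  have b1' := abs_sub_comm (q + d.vec).1 r.1 ▸ b1
  have b2' := abs_sub_comm (q + d.vec).2 r.2 ▸ b2
  have lr := h.len_eq hr s
  have st := h.valid.step s trivial r hr
  have hle := Nat.min_le_right t (len g N r s)
  rw [fine] at e
  set τ := min t (len g N r s)
  set c := q + d.vec with hcdef
  have e1 : c.1 + N * w.1 = r.1 + N * (g r s).1 + τ * (cyc s).vec.1 := by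
    have := congrArg Prod.fst e
    simp only [Prod.fst_add, Prod.smul_fst, smul_eq_mul, hcdef] at this ⊢
    rw [nsmul_eq_mul] at this
    linarith
  have e2 : c.2 + N * w.2 = r.2 + N * (g r s).2 + τ * (cyc s).vec.2 := by
    have := congrArg Prod.snd e
    simp only [Prod.snd_add, Prod.smul_snd, smul_eq_mul, hcdef] at this ⊢
    rw [nsmul_eq_mul] at this
    linarith
  clear_value τ c
  revert lr st e1 e2
  have lex1 : ∀ a, r.1 + N * a ≤ c.1 + N * w.1 → LexLE a r.1 w.1 c.1 := fun a => lexLE_of_le b1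
  have lex2 : ∀ a, r.2 + N * a ≤ c.2 + N * w.2 → LexLE a r.2 w.2 c.2 := fun a => lexLE_of_le b2
  have lex3 : ∀ a, c.1 + N * w.1 ≤ r.1 + N * a → LexLE w.1 c.1 a r.1 := fun a => lexLE_of_le b1'
  have lex4 : ∀ a, c.2 + N * w.2 ≤ r.2 + N * a → LexLE w.2 c.2 a r.2 := fun a => lexLE_of_le b2'
  cases cyc s <;> simp only [StepTo, across, along, Dir.vec, mul_one, mul_zero, add_zero,
      mul_neg] <;>
    intro lr st e1 e2
  · refine ⟨.inl ⟨lex1 _ (by omega), lex3 _ (by omega)⟩, .inl ⟨lex2 _ (by omega), lex4 _ ?_⟩⟩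
    rw [← st.1]; omega
  · refine ⟨.inl ⟨lex1 _ (by omega), lex3 _ ?_⟩, .inl ⟨lex2 _ (by omega), lex4 _ (by omega)⟩⟩
    rw [← st.1]; omega
  · refine ⟨.inr ⟨lex1 _ (by omega), lex3 _ (by omega)⟩, .inl ⟨lex2 _ (by omega), lex4 _ ?_⟩⟩
    rw [← st.1]; omega
  · refine ⟨.inl ⟨lex1 _ (by omega), lex3 _ ?_⟩, .inr ⟨lex2 _ (by omega), lex4 _ (by omega)⟩⟩
    rw [← st.1]; omega

/-- A tile that has come to rest is held, through tiles at rest, by an obstacle. -/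
theorem Eternal.exists_stopper {P : Finset Cell} {g : Cell → ℤ → Cell} {S N : ℤ}
    (h : Eternal P g S N) {p : Cell} (hp : p ∈ P) {s : ℤ} {t : ℕ} (ht : len g N p s ≤ t) :
    ∃ q ∈ P, fine g N q s t + (cyc s).vec ∉ swept P g N ∧
      fine g N q s t = q + N • g p (s + 1) ∧
      Linked {r | r ∈ P ∧ fine g N r s t = r + N • g p (s + 1)} q p := by
  obtain ⟨q, hq, hend, hstart, hnohit⟩ := h.valid.halt s trivial p hp
  have lp := h.len_eq hp s
  have arrive : ∀ r ∈ P, g r (s + 1) = g p (s + 1) → ¬ Ahead (cyc s) (g r s) (g p s) →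
      fine g N r s t = r + N • g p (s + 1) := by
    intro r hr e hna
    have lr := h.len_eq hr s
    rw [e] at lr
    have hac : across (cyc s) (g r s) = across (cyc s) (g p s) := by
      rw [(h.valid.step s trivial r hr).1, e, (h.valid.step s trivial p hp).1]
    have hle : along (cyc s) (g p s) ≤ along (cyc s) (g r s) := by
      by_contra! hlt
      exact hna ⟨hac, hlt⟩
    have := mul_le_mul_of_nonneg_left hle (show 0 ≤ N by have := h.scale_pos; omega)
    rw [h.fine_end hr (by omega), e]
  have hna : ¬ Ahead (cyc s) (g q s) (g p s) := by
    rcases hstart with e | ⟨e, -⟩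
    · rw [e]; exact fun ha => lt_irrefl _ ha.2
    · exact fun ha => lt_asymm e.2 ha.2
  refine ⟨q, hq, ?_, arrive q hq hend hna, ?_⟩
  · intro hz
    rw [arrive q hq hend hna] at hz
    obtain ⟨r, hr, s', hh⟩ := h.hit_of_swept hq hz
    rw [← hend] at hh
    exact hnohit r hr s' trivial hh
  -- If `q` set out together with `p`, the tiles that started with them form the link. Otherwise `p`
  -- is among the last to arrive, and all tiles bound for this vertex are already in place.
  · rcases hstart with e | ⟨-, hlast⟩
    · refine Linked.mono ?_ (h.valid.conn s trivial q hq p hp e)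
      rintro r ⟨hr, hr'⟩
      refine ⟨hr, arrive r hr (h.valid.together s trivial r hr p hp (hr'.trans e)) ?_⟩
      rw [hr', e]
      exact fun ha => lt_irrefl _ ha.2
    · refine Linked.mono ?_ (h.valid.conn (s + 1) trivial q hq p hp hend)
      rintro r ⟨hr, hr'⟩
      exact ⟨hr, arrive r hr (hr'.trans hend) (hlast r hr (hr'.trans hend))⟩

/-- The square of radius `R`. -/
noncomputable def box (R : ℤ) : Finset Cell := Finset.Icc (-R, -R) (R, R)

theorem mem_box {R : ℤ} {z : Cell} :
    z ∈ box R ↔ (-R ≤ z.1 ∧ z.1 ≤ R) ∧ -R ≤ z.2 ∧ z.2 ≤ R := by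
  simp only [box, Finset.mem_Icc, Prod.le_def]
  tauto

theorem Eternal.exists_box {P : Finset Cell} {g : Cell → ℤ → Cell} {S N : ℤ}
    (h : Eternal P g S N) (a b : ℤ) :
    ∃ R, ∀ p ∈ P, ∀ s, a ≤ s → s ≤ b → ∀ t, fine g N p s t ∈ box R := by
  obtain ⟨R, hR⟩ := ((P ×ˢ Finset.Icc a (b + 1)).image fun x : Cell × ℤ =>
    max |(x.1 + N • g x.1 x.2).1| |(x.1 + N • g x.1 x.2).2|).bddAbove
  have key : ∀ p ∈ P, ∀ s, a ≤ s → s ≤ b + 1 →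
      ((-R ≤ (p + N • g p s).1 ∧ (p + N • g p s).1 ≤ R) ∧
      -R ≤ (p + N • g p s).2 ∧ (p + N • g p s).2 ≤ R) := by
    intro p hp s h1 h2
    have := max_le_iff.1 (hR (Finset.mem_coe.2 (Finset.mem_image.2
      ⟨(p, s), by simp [hp, h1, h2], rfl⟩)))
    exact ⟨abs_le.1 this.1, abs_le.1 this.2⟩
  refine ⟨R, fun p hp s h1 h2 t => mem_box.2 ?_⟩
  have k1 := key p hp s h1 (by omega)
  have k2 := key p hp (s + 1) (by omega) (by omega)
  rw [← h.fine_end hp le_rfl] at k2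
  rw [← fine_zero] at k1
  revert k1 k2
  have hle := Nat.min_le_right t (len g N p s)
  simp only [fine, min_self, Nat.zero_min]
  cases cyc s <;> simp [Dir.vec] <;> omega

/-! ## A workspace in which delayed copies of a flow run -/

/-- In the workspace `W`, the particle `i` is the tile `tile i` of a copy of `P` that follows the
trajectories `g` with the delay `lag i`, in the first `M` steps. -/
structure Runs {P : Finset Cell} {g : Cell → ℤ → Cell} {S N : ℤ} (h : Eternal P g S N)
    (W : Workspace) (tile : Fin W.n → Cell) (lag : Fin W.n → ℤ) (M : ℕ) : Prop where
  mem : ∀ i, tile i ∈ P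
  color : ∀ i, W.color i = tileColor (tile i)
  start : ∀ i, W.start i = fine g N (tile i) (-lag i) 0
  lag_mod : ∀ i, lag i % 7 = 0
  full : ∀ i, ∀ q ∈ P, ∃ j, tile j = q ∧ lag j = lag i
  inj : ∀ i j, tile i = tile j → lag i = lag j → i = j
  swept : ∀ z ∈ W.room, z ∈ swept P g N
  room : ∀ i, ∀ m < M, ∀ t, fine g N (tile i) ((m : ℕ) - lag i) t ∈ W.room

/-- The positions of the particles after `m` steps and `t` unit motions. -/
def Runs.pos {P : Finset Cell} {g : Cell → ℤ → Cell} {S N : ℤ} {h : Eternal P g S N}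
    {W : Workspace} {tile : Fin W.n → Cell} {lag : Fin W.n → ℤ} {M : ℕ}
    (_ : Runs h W tile lag M) (m t : ℕ) (i : Fin W.n) : Cell :=
  fine g N (tile i) (m - lag i) t

theorem fine_succ {g : Cell → ℤ → Cell} {N : ℤ} {p : Cell} {s : ℤ} {t : ℕ} (ht : t < len g N p s) :
    fine g N p s (t + 1) = fine g N p s t + (cyc s).vec := by
  rw [fine, fine, min_eq_left ht.le, min_eq_left (Nat.succ_le_of_lt ht), succ_nsmul, ← add_assoc]

theorem Runs.cyc_eq {P : Finset Cell} {g : Cell → ℤ → Cell} {S N : ℤ} {h : Eternal P g S N}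
    {W : Workspace} {tile : Fin W.n → Cell} {lag : Fin W.n → ℤ} {M : ℕ}
    (r : Runs h W tile lag M) (m : ℕ) (i : Fin W.n) : sevenCycle m = cyc (m - lag i) := by
  rw [sevenCycle_eq_cyc]
  have := r.lag_mod i
  exact cyc_congr (by omega)

/-- By induction on blockedness, a tile that still has to move faces only swept cells, and no
resting tile stops it. Conversely, a resting tile is connected through sticking resting tiles to one
that faces an unswept cell, hence an obstacle. -/
theorem Runs.blocked_iff {P : Finset Cell} {g : Cell → ℤ → Cell} {S N : ℤ} {h : Eternal P g S N}
    {W : Workspace} {tile : Fin W.n → Cell} {lag : Fin W.n → ℤ} {M : ℕ}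
    (r : Runs h W tile lag M) {m : ℕ} (hm : m < M) (t : ℕ) (i : Fin W.n) :
    W.Blocked (sevenCycle m) (r.pos m t) i ↔ len g N (tile i) (m - lag i) ≤ t := by
  have hmod : ∀ i j, ((m : ℤ) - lag i) % 7 = ((m : ℤ) - lag j) % 7 := by
    intro i j
    have := r.lag_mod i
    have := r.lag_mod j
    omega
  constructor
  · intro hb
    induction hb with
    | obstacle i hi =>
      by_contra! ht
      refine hi ?_
      rw [r.cyc_eq m i, Runs.pos, ← fine_succ ht]
      exact r.room i m hm _
    | behind i j e _ ih =>
      by_contra! ht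
      refine (h.moving_clear (r.mem i) (r.mem j) (hmod i j) ht ih).1 ?_
      rw [← r.cyc_eq m i]
      exact e
    | stuck i j e _ ih =>
      by_contra! ht
      refine (h.moving_clear (r.mem i) (r.mem j) (hmod i j) ht ih).2 ⟨?_, e.2⟩
      rw [← r.color, ← r.color]
      exact e.1
  · intro ht
    obtain ⟨q, hq, hout, hend, hl⟩ := h.exists_stopper (r.mem i) ht
    rw [← r.cyc_eq m i] at hout
    have key : ∀ p, Linked {r | r ∈ P ∧ fine g N r (m - lag i) t =
        r + N • g (tile i) (m - lag i + 1)} q p →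
        fine g N p (m - lag i) t = p + N • g (tile i) (m - lag i + 1) ∧
        ∃ j, tile j = p ∧ lag j = lag i ∧ W.Blocked (sevenCycle m) (r.pos m t) j := by
      intro p hp
      induction hp with
      | refl =>
        obtain ⟨j, hj, hj'⟩ := r.full i q hq
        refine ⟨hend, j, hj, hj', .obstacle j fun hmem => hout ?_⟩
        rw [Runs.pos, hj, hj'] at hmem
        exact r.swept _ hmem
      | tail _ hbc ih =>
        obtain ⟨hadj, hc, hc'⟩ := hbc
        obtain ⟨hb, j, hj, hj', hblock⟩ := ih
        obtain ⟨k, hk, hk'⟩ := r.full i _ hc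
        refine ⟨hc', k, hk, hk', .stuck k j ⟨?_, ?_⟩ hblock⟩
        · rw [r.color, r.color, hj, hk]
          exact tileColor_ne_of_adj hadj.symm
        · rw [Runs.pos, Runs.pos, hk, hk', hj, hj', hb, hc', gridGraph_adj_add]
          exact hadj.symm
    obtain ⟨-, j, hj, hj', hb⟩ := key _ hl
    rwa [r.inj j i hj hj'] at hb

theorem Runs.unitMotion_pos {P : Finset Cell} {g : Cell → ℤ → Cell} {S N : ℤ}
    {h : Eternal P g S N} {W : Workspace} {tile : Fin W.n → Cell} {lag : Fin W.n → ℤ} {M : ℕ}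
    (r : Runs h W tile lag M) {m : ℕ} (hm : m < M) (t : ℕ) :
    W.unitMotion (sevenCycle m) (r.pos m t) = r.pos m (t + 1) := by
  funext i
  by_cases ht : len g N (tile i) (m - lag i) ≤ t
  · rw [Workspace.unitMotion, if_pos ((r.blocked_iff hm t i).2 ht), Runs.pos, Runs.pos,
      h.fine_end (r.mem i) ht, h.fine_end (r.mem i) (by omega)]
  · rw [Workspace.unitMotion, if_neg (fun hb => ht ((r.blocked_iff hm t i).1 hb)), Runs.pos,
      Runs.pos, fine_succ (not_le.1 ht), r.cyc_eq m i]

theorem Runs.iterate_pos {P : Finset Cell} {g : Cell → ℤ → Cell} {S N : ℤ}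
    {h : Eternal P g S N} {W : Workspace} {tile : Fin W.n → Cell} {lag : Fin W.n → ℤ} {M : ℕ}
    (r : Runs h W tile lag M) {m : ℕ} (hm : m < M) (t : ℕ) :
    (W.unitMotion (sevenCycle m))^[t] (r.pos m 0) = r.pos m t := by
  induction t with
  | zero => rfl
  | succ t ih => rw [Function.iterate_succ_apply', ih, r.unitMotion_pos hm]

/-- The cells passed within a step are distinct cells of the room, so `W.room.card` unit motions
complete every step. -/
theorem Runs.len_le {P : Finset Cell} {g : Cell → ℤ → Cell} {S N : ℤ}
    {h : Eternal P g S N} {W : Workspace} {tile : Fin W.n → Cell} {lag : Fin W.n → ℤ} {M : ℕ}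
    (r : Runs h W tile lag M) {m : ℕ} (hm : m < M) (i : Fin W.n) :
    len g N (tile i) (m - lag i) ≤ W.room.card := by
  rw [← Finset.card_range (len g N (tile i) (m - lag i))]
  refine Finset.card_le_card_of_injOn (fun t => fine g N (tile i) (m - lag i) t)
    (fun t _ => r.room i m hm t) ?_
  intro t ht t' ht' e
  rw [Finset.coe_range, Set.mem_Iio] at ht ht'
  have := congrArg (along (cyc (m - lag i))) e
  simp only [along_fine] at this
  omega

theorem Runs.config_eq {P : Finset Cell} {g : Cell → ℤ → Cell} {S N : ℤ}
    {h : Eternal P g S N} {W : Workspace} {tile : Fin W.n → Cell} {lag : Fin W.n → ℤ} {M : ℕ}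
    (r : Runs h W tile lag M) {m : ℕ} (hm : m ≤ M) : W.config sevenCycle m = r.pos m 0 := by
  induction m with
  | zero =>
    funext i
    rw [Workspace.config, r.start, Runs.pos, Nat.cast_zero, zero_sub]
  | succ m ih =>
    funext i
    rw [Workspace.config, ih (by omega), Workspace.move, r.iterate_pos hm, Runs.pos, Runs.pos,
      h.fine_end (r.mem i) (r.len_le hm i), fine_zero, Nat.cast_succ, sub_add_eq_add_sub]

/-- Particles only begin to stick together while the copy to which they belong is being built. -/
theorem Runs.bond_new {P : Finset Cell} {g : Cell → ℤ → Cell} {S N : ℤ}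
    {h : Eternal P g S N} {W : Workspace} {tile : Fin W.n → Cell} {lag : Fin W.n → ℤ} {M : ℕ}
    (r : Runs h W tile lag M) {m t : ℕ} {i j : Fin W.n}
    (hold : ¬ (bondGraph W.color (r.pos m t)).Adj i j)
    (hnew : (bondGraph W.color (r.pos m (t + 1))).Adj i j) :
    -S ≤ m - lag i ∧ m - lag i < 0 := by
  have hmod : ((m : ℤ) - lag i) % 7 = ((m : ℤ) - lag j) % 7 := by
    have := r.lag_mod i
    have := r.lag_mod j
    omega
  obtain ⟨hs, hc⟩ := h.bond_cases (r.mem i) (r.mem j) hmod hnew.2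
  -- Tiles that start the step at one vertex move in parallel, so their bond would be old; only
  -- merging vertices create bonds.
  rcases hc with hc | ⟨hne, hc⟩
  · refine (hold ⟨hnew.1, ?_⟩).elim
    have hlen : len g N (tile i) (m - lag i) = len g N (tile j) (m - lag i) := by
      rw [len, len, hc, h.valid.together _ trivial _ (r.mem i) _ (r.mem j) hc]
    have := hnew.2
    rw [Runs.pos, Runs.pos, ← hs] at this ⊢
    simp only [fine, hc, hlen, add_assoc, gridGraph_adj_add] at this ⊢
    exact this
  -- No two tiles share a vertex up to time `-S`, and all of them do from time `0` on.
  · constructor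
    · by_contra! hlt
      exact h.loose (m - lag i + 1) (by omega) _ (r.mem i) _ (r.mem j)
        (fun e => hne (by rw [e])) hc
    · by_contra! hle
      exact hne (by rw [h.joined _ (r.mem i) _ hle, h.joined _ (r.mem j) _ hle])

/-! ### Counting finished copies -/

/-- The tiles of a copy that has been built form an assembly. -/
theorem Runs.supp_eq {P : Finset Cell} {g : Cell → ℤ → Cell} {S N : ℤ}
    {h : Eternal P g S N} {W : Workspace} {tile : Fin W.n → Cell} {lag : Fin W.n → ℤ} {M : ℕ}
    (r : Runs h W tile lag M) {m : ℕ} {i : Fin W.n} (hi : lag i ≤ m) :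
    ((bondGraph W.color (r.pos m 0)).connectedComponentMk i).supp = {k | lag k = lag i} := by
  have hpos : ∀ k, lag k = lag i → r.pos m 0 k = tile k + N • conv (m - lag i) := by
    intro k hk
    rw [Runs.pos, fine_zero, hk, h.joined _ (r.mem k) _ (by omega)]
  ext k
  rw [SimpleGraph.ConnectedComponent.mem_supp_iff, SimpleGraph.ConnectedComponent.eq,
    Set.mem_ofPred_eq]
  constructor
  · rintro ⟨w⟩
    induction w with
    | nil => rfl
    | cons hadj _ ih =>
      rename_i u v w _
      rw [← ih hi hpos]
      have hmod : ((m : ℤ) - lag u) % 7 = ((m : ℤ) - lag v) % 7 := by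
        have := r.lag_mod u
        have := r.lag_mod v
        omega
      have := (h.bond_cases (r.mem u) (r.mem v) hmod hadj.2).1
      omega
  · intro hk
    have key : ∀ p, Linked (P : Set Cell) (tile i) p →
        ∃ j, tile j = p ∧ lag j = lag i ∧ (bondGraph W.color (r.pos m 0)).Reachable j i := by
      intro p hp
      induction hp with
      | refl => exact ⟨i, rfl, rfl, .refl _⟩
      | tail _ hbc ih =>
        obtain ⟨j, hj, hj', hr⟩ := ih
        obtain ⟨l, hl, hl'⟩ := r.full i _ hbc.2
        refine ⟨l, hl, hl', SimpleGraph.Reachable.trans (SimpleGraph.Adj.reachable ⟨?_, ?_⟩) hr⟩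
        · rw [r.color, r.color, hj, hl]
          exact tileColor_ne_of_adj hbc.1.symm
        · rw [hpos l hl', hpos j hj', gridGraph_adj_add, hj, hl]
          exact hbc.1.symm
    obtain ⟨j, hj, hj', hr⟩ := key _ (h.poly.linked (r.mem i) (r.mem k))
    rwa [r.inj j k hj (hj'.trans hk.symm)] at hr

theorem Runs.le_copies {P : Finset Cell} {g : Cell → ℤ → Cell} {S N : ℤ}
    {h : Eternal P g S N} {W : Workspace} {tile : Fin W.n → Cell} {lag : Fin W.n → ℤ} {M : ℕ}
    (r : Runs h W tile lag M) {m n : ℕ} (f : Fin n → Fin W.n)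
    (hf : Function.Injective fun a => lag (f a)) (hlag : ∀ a, lag (f a) ≤ m) :
    n ≤ W.copies (r.pos m 0) P := by
  set c : Fin n → (bondGraph W.color (r.pos m 0)).ConnectedComponent :=
    fun a => (bondGraph W.color (r.pos m 0)).connectedComponentMk (f a) with hc
  have hinj : Function.Injective c := by
    intro a b hab
    refine hf ?_
    have h1 : f a ∈ (c b).supp := by
      rw [← hab]
      exact SimpleGraph.ConnectedComponent.connectedComponentMk_mem
    rw [hc, r.supp_eq (hlag b)] at h1
    exact h1
  have hcard : (Set.range c).ncard = n := by
    rw [← Set.image_univ, Set.ncard_image_of_injective _ hinj, Set.ncard_univ, Nat.card_fin]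
  rw [← hcard]
  refine Set.ncard_le_ncard ?_ (Set.toFinite _)
  rintro _ ⟨a, rfl⟩
  refine ⟨N • conv (m - lag (f a)), ?_⟩
  rw [hc, r.supp_eq (hlag a)]
  have hpos : ∀ k, lag k = lag (f a) → r.pos m 0 k = tile k + N • conv (m - lag (f a)) := by
    intro k hk
    have := hlag a
    rw [Runs.pos, fine_zero, hk, h.joined _ (r.mem k) _ (by omega)]
  ext z
  constructor
  · rintro ⟨k, hk, rfl⟩
    exact ⟨tile k, r.mem k, (hpos k hk).symm⟩
  · rintro ⟨p, hp, rfl⟩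
    obtain ⟨k, hk, hk'⟩ := r.full (f a) p hp
    exact ⟨k, hk', by rw [hpos k hk', hk]⟩

/-- The depot of each copy is its own trajectory frozen at time `-lag`. Every delay is at least `7 *
c ≥ S`, so the tiles start loose; validity across copies keeps different copies apart. -/
theorem Eternal.exists_runs {P : Finset Cell} {g : Cell → ℤ → Cell} {S N : ℤ}
    (h : Eternal P g S N) {c D : ℕ} (hc : S ≤ 7 * c) {room : Finset Cell}
    (hswept : ∀ z ∈ room, z ∈ TiltAssembly.swept P g N)
    (hroom : ∀ p ∈ P, ∀ s, -(7 * (c + D) : ℤ) ≤ s → s ≤ 7 * D → ∀ t, fine g N p s t ∈ room) :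
    ∃ (W : Workspace) (tile : Fin W.n → Cell) (lag : Fin W.n → ℤ), W.room = room ∧
      Runs h W tile lag (7 * (c + D)) ∧
      ∀ a : Fin D, ∃ i, lag i = 7 * (c + a + 1) := by
  classical
  set e := Fintype.equivFin (Fin D × P)
  set tile : Fin (Fintype.card (Fin D × P)) → Cell := fun i => (e.symm i).2 with htile
  set lag : Fin (Fintype.card (Fin D × P)) → ℤ := fun i => 7 * (c + (e.symm i).1 + 1) with hlag
  have mem : ∀ i, tile i ∈ P := fun i => (e.symm i).2.2
  have inj : ∀ i j, tile i = tile j → lag i = lag j → i = j := by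
    intro i j h1 h2
    refine e.symm.injective (Prod.ext (Fin.ext ?_) (Subtype.ext h1))
    simp only [hlag] at h2
    omega
  have bound : ∀ i, 7 * c + 7 ≤ lag i ∧ lag i ≤ 7 * (c + D) := by
    intro i
    have := (e.symm i).1.2
    simp only [hlag]
    omega
  have hmod : ∀ i, lag i % 7 = 0 := fun i => by simp only [hlag]; omega
  have same : ∀ i j, (tile i + N • g (tile i) (-lag i) = tile j + N • g (tile j) (-lag j) ∨
      gridGraph.Adj (tile i + N • g (tile i) (-lag i)) (tile j + N • g (tile j) (-lag j))) →
      lag i = lag j ∧ g (tile i) (-lag i) = g (tile j) (-lag j) := by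
    intro i j hij
    have hg := h.rest_eq (mem i) (mem j) hij
    refine ⟨?_, hg⟩
    by_contra hne
    have h1 := hmod i
    have h2 := hmod j
    exact (h.valid.apart (-lag i) trivial (-lag j) trivial (by omega) (by omega) _ (mem i) _
      (mem j)).1 hg
  let W : Workspace :=
    { room := room
      n := Fintype.card (Fin D × P)
      color := fun i => tileColor (tile i)
      start := fun i => tile i + N • g (tile i) (-lag i)
      start_injective := by
        intro i j hij
        obtain ⟨h1, h2⟩ := same i j (.inl hij)
        refine inj i j ?_ h1
        dsimp only at hij
        rw [h2] at hij
        exact add_right_cancel hij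
      start_mem := by
        intro i
        rw [← fine_zero]
        have := bound i
        exact hroom _ (mem i) _ (by omega) (by omega) _
      start_loose := by
        rintro i j ⟨hcol, hadj⟩
        obtain ⟨h1, h2⟩ := same i j (.inr hadj)
        rw [h1] at h2
        have := bound j
        exact h.loose (-lag j) (by omega) _ (mem i) _ (mem j)
            (fun e => hcol (congrArg tileColor e)) h2 }
  have full : ∀ a : Fin D, ∀ q ∈ P, ∃ j, tile j = q ∧ lag j = 7 * (c + a + 1) :=
    fun a q hq => ⟨e (a, ⟨q, hq⟩), by simp [htile], by simp [hlag]⟩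
  refine ⟨W, tile, lag, rfl, ⟨mem, fun _ => rfl, fun i => (fine_zero _ _).symm, hmod, ?_, inj,
    hswept, ?_⟩, ?_⟩
  · exact fun i q hq => full (e.symm i).1 q hq
  · intro i m hm t
    have := bound i
    exact hroom _ (mem i) _ (by omega) (by omega) t
  · intro a
    obtain ⟨p, hp⟩ := h.poly.nonempty
    obtain ⟨i, -, hi⟩ := full a p hp
    exact ⟨i, hi⟩

theorem box_mono {R R' : ℤ} (hR : R ≤ R') : box R ⊆ box R' := by
  intro z hz
  rw [mem_box] at hz ⊢
  omega

theorem Eternal.pipelineConstructs {P : Finset Cell} {g : Cell → ℤ → Cell} {S N : ℤ}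
    (h : Eternal P g S N) : ∃ (B L : Finset Cell) (c : ℕ), PipelineConstructs B L c P := by
  classical
  -- Bonds form only at times in `[-S, 0)` of the copy's own clock, so this box serves for every
  -- `D`. The start-up of `S.toNat` cycles is ample, as `S.toNat` steps would suffice.
  obtain ⟨R, hR⟩ := h.exists_box (-S) 0
  refine ⟨box R, (box R).filter (· ∈ swept P g N), S.toNat, fun D => ?_⟩
  have hS := Int.self_le_toNat S
  generalize S.toNat = c at hS
  -- The copies' clocks stay in this range during `7 * (c + D)` steps, since the delays lie between
  -- `7 * c + 7` and `7 * (c + D)`.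
  obtain ⟨R', hR'⟩ := h.exists_box (-(7 * (c + D) : ℤ)) (7 * D)
  obtain ⟨W, tile, lag, hroom, r, hlag⟩ := h.exists_runs (c := c) (D := D)
    (room := (box (max R R')).filter (· ∈ swept P g N)) (by omega)
    (fun z hz => (Finset.mem_filter.1 hz).2)
    (fun p hp s h1 h2 t => Finset.mem_filter.2
      ⟨box_mono (le_max_right _ _) (hR' p hp s h1 h2 t), p, hp, s, t, rfl⟩)
  have copies : ∀ j ≤ D, j ≤ W.copies (W.config sevenCycle (7 * (c + j))) P := by
    intro j hj
    rw [r.config_eq (by omega)]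
    choose f hf using hlag
    refine r.le_copies (fun a : Fin j => f (Fin.castLE hj a)) ?_ ?_
    · intro a b hab
      dsimp only at hab
      rw [hf, hf] at hab
      simp only [Fin.val_castLE] at hab
      exact Fin.ext (by omega)
    · intro a
      have := a.2
      rw [hf]
      push_cast [Fin.val_castLE]
      omega
  refine ⟨W, ?_, ?_, copies 1, copies⟩
  · ext z
    rw [hroom]
    simp only [Finset.mem_inter, Finset.mem_filter]
    exact ⟨fun hz => ⟨hz.2, hz.1.2⟩,
      fun hz => ⟨⟨box_mono (le_max_left _ _) hz.1, hz.2⟩, hz.1⟩⟩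
  · intro m hm t i j hold hnew
    rw [r.config_eq hm.le, r.iterate_pos hm] at hold hnew ⊢
    have h1 := r.bond_new hold hnew
    have h2 := r.bond_new (fun e => hold e.symm) hnew.symm
    exact ⟨hR _ (r.mem i) _ h1.1 h1.2.le _, hR _ (r.mem j) _ h2.1 h2.2.le _⟩

end TiltAssembly

theorem mainTheorem8 (P : Finset TiltAssembly.Cell) (T : TiltAssembly.DecompositionTree P) :
    ∃ (B L : Finset TiltAssembly.Cell) (c : ℕ), TiltAssembly.PipelineConstructs B L c P := by
  obtain ⟨hP, g, h, S, hf⟩ := T.hasFlow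
  obtain ⟨G, S', N, hG⟩ := hf.eternal hP
  exact hG.pipelineConstructs
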